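/- Let $n\ge 0$ be an integer, $k=\lfloor n/2\rfloor$, and let $E_{p,q}$ denote the $n\times n$ matrix units. Put $\Omega_n=\sum_{i=1}^n(-1)^{i+1}E_{i,n+1-i}$ and $G(\Omega_n)=\{A\in GL_n(\mathbb C)\mid A\,\Omega_n A^{t}=\Omega_n\}$, which is the symplectic group $Sp_{2k}$ for $n=2k$ and the orthogonal group $O_{2k+1}$ for $n=2k+1$. Let $T\subset G(\Omega_n)$ be the group of diagonal matrices with diagonal entries $x_1,\dots,x_k,x_k^{-1},\dots,x_1^{-1}$ if $n=2k$, and $x_1,\dots,x_k,\pm1,x_k^{-1},\dots,x_1^{-1}$ if $n=2k+1$, where $x_i\in\mathbb C^*$, and let $$T_{>0}=\{H\in T\mid \chi(H)\in\mathbb R_{>0}\text{ for every algebraic character }\chi\colon T\to\mathbb C^*\}.$$ For $1\le i<k$ let $E_i=E_{i,i+1}+E_{n-i,n-i+1}$; let $E_k=E_{k,k+1}$ if $n=2k$ and $E_k=\sqrt2\,(E_{k,k+1}+E_{k+1,k+2})$ if $n=2k+1$ (for $k\ge1$); and let $F_i=E_i^{t}$ for all $i$. Let $G_{\ge0}(\Omega_n)$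 be the submonoid generated by $T_{>0}$ and by all $\exp(tE_i)$ and $\exp(tF_i)$ with $1\le i\le k$ and real $t>0$. A matrix is called totally nonnegative if all of its minors are nonnegative real numbers. If $A\in G(\Omega_n)$ is totally nonnegative as an $n\times n$ matrix, then $A\in G_{\ge0}(\Omega_n)$. Consequently, $G_{\ge0}(\Omega_n)$ is exactly the set of totally nonnegative matrices in $G(\Omega_n)$. -/

import Mathlib

namespace TotalPos

open Matrix

noncomputable section

/-- The matrix unit `E_{p,q}` of size `n`, with the usual indices `p, q` running from `1` to `n`
(rows and columns of `Matrix (Fin n) (Fin n) ℂ` are numbered from `0`). -/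
def unitMat (n p q : ℕ) : Matrix (Fin n) (Fin n) ℂ :=
  Matrix.of fun a b => if (a : ℕ) + 1 = p ∧ (b : ℕ) + 1 = q then 1 else 0

/-- The antidiagonal form `Ω_n = ∑_{i=1}^n (-1)^{i+1} E_{i,n+1-i}`; in indices starting from `0`,
the entry `(a, b)` is `(-1)^a` if `a + b + 1 = n` and `0` otherwise. -/
def Omega (n : ℕ) : Matrix (Fin n) (Fin n) ℂ :=
  Matrix.of fun a b => if (a : ℕ) + b + 1 = n then (-1) ^ (a : ℕ) else 0

/-- The group `G(Ω_n) = {A ∈ GL_n(ℂ) | A Ω_n Aᵗ = Ω_n}`: symplectic for even `n`,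
orthogonal for odd `n`. -/
def GOmega (n : ℕ) : Subgroup (GL (Fin n) ℂ) where
  carrier := {A | (A : Matrix (Fin n) (Fin n) ℂ) * Omega n *
    (A : Matrix (Fin n) (Fin n) ℂ)ᵀ = Omega n}
  one_mem' := by simp
  mul_mem' := by
    intro A B hA hB
    simp only [Set.mem_ofPred_eq, Units.val_mul, Matrix.transpose_mul] at *
    calc (A : Matrix (Fin n) (Fin n) ℂ) * B * Omega n * ((B : Matrix (Fin n) (Fin n) ℂ)ᵀ *
          (A : Matrix (Fin n) (Fin n) ℂ)ᵀ)
        = A * (B * Omega n * (B : Matrix (Fin n) (Fin n) ℂ)ᵀ) *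
          (A : Matrix (Fin n) (Fin n) ℂ)ᵀ := by simp only [Matrix.mul_assoc]
      _ = Omega n := by rw [hB, hA]
  inv_mem' := by
    intro A hA
    simp only [Set.mem_ofPred_eq] at *
    have h1 : ((A⁻¹ : GL (Fin n) ℂ) : Matrix (Fin n) (Fin n) ℂ) * A = 1 := by
      rw [← Units.val_mul]; simp
    have h2 : (A : Matrix (Fin n) (Fin n) ℂ)ᵀ *
        ((A⁻¹ : GL (Fin n) ℂ) : Matrix (Fin n) (Fin n) ℂ)ᵀ = 1 := by
      rw [← Matrix.transpose_mul, h1, Matrix.transpose_one]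
    calc ((A⁻¹ : GL (Fin n) ℂ) : Matrix (Fin n) (Fin n) ℂ) * Omega n *
          ((A⁻¹ : GL (Fin n) ℂ) : Matrix (Fin n) (Fin n) ℂ)ᵀ
        = ((A⁻¹ : GL (Fin n) ℂ) : Matrix (Fin n) (Fin n) ℂ) *
            (A * Omega n * (A : Matrix (Fin n) (Fin n) ℂ)ᵀ) *
          ((A⁻¹ : GL (Fin n) ℂ) : Matrix (Fin n) (Fin n) ℂ)ᵀ := by rw [hA]
      _ = (((A⁻¹ : GL (Fin n) ℂ) : Matrix (Fin n) (Fin n) ℂ) * A) * Omega n *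
            ((A : Matrix (Fin n) (Fin n) ℂ)ᵀ *
          ((A⁻¹ : GL (Fin n) ℂ) : Matrix (Fin n) (Fin n) ℂ)ᵀ) := by
            simp only [Matrix.mul_assoc]
      _ = Omega n := by rw [h1, h2, Matrix.one_mul, Matrix.mul_one]

/-- A complex matrix is totally nonnegative if all its minors (of all sizes) are
nonnegative real numbers. -/
def IsTotallyNonneg {n : ℕ} (A : Matrix (Fin n) (Fin n) ℂ) : Prop :=
  ∀ (m : ℕ) (r c : Fin m ↪o Fin n), ∃ x : ℝ, 0 ≤ x ∧ (A.submatrix r c).det = (x : ℂ)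

/-- The maximal torus of `G(Ω_n)`: diagonal matrices with diagonal entries
`x_1, …, x_k, x_k⁻¹, …, x_1⁻¹` for `n = 2k`, and `x_1, …, x_k, ±1, x_k⁻¹, …, x_1⁻¹`
for `n = 2k + 1`. -/
def torus (n : ℕ) : Subgroup (GL (Fin n) ℂ) where
  carrier := {H | ∃ x : Fin n → ℂˣ, (∀ i, x i * x i.rev = 1) ∧
    (H : Matrix (Fin n) (Fin n) ℂ) = Matrix.diagonal fun i => (x i : ℂ)}
  one_mem' := ⟨fun _ => 1, by simp, by simp⟩
  mul_mem' := by
    rintro A B ⟨x, hx, hA⟩ ⟨y, hy, hB⟩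
    refine ⟨fun i => x i * y i, fun i => ?_, ?_⟩
    · rw [mul_mul_mul_comm, hx, hy, one_mul]
    · simp [hA, hB]
  inv_mem' := by
    rintro A ⟨x, hx, hA⟩
    refine ⟨fun i => (x i)⁻¹, fun i => ?_, ?_⟩
    · rw [← mul_inv, hx, inv_one]
    · have h : A * Units.mk (Matrix.diagonal fun i => ((x i)⁻¹ : ℂ))
          (Matrix.diagonal fun i => (x i : ℂ)) (by simp) (by simp) = 1 := by
        ext1
        simp [hA]
      rw [← eq_inv_of_mul_eq_one_right h]
      simp

/-- The standard generators of the coordinate ring of `GL_n`, evaluated at `g`: the matrix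
entries and the inverse of the determinant. -/
def coords {n : ℕ} (g : GL (Fin n) ℂ) : Option (Fin n × Fin n) → ℂ
  | none => ((g : Matrix (Fin n) (Fin n) ℂ).det)⁻¹
  | some ij => (g : Matrix (Fin n) (Fin n) ℂ) ij.1 ij.2

/-- A group homomorphism `T → ℂ*` is a character of the algebraic group `T ⊆ GL_n` if it is a
regular function on `T`: a polynomial in the matrix entries and the inverse of the determinant. -/
def IsAlgebraicCharacter {n : ℕ} (χ : torus n →* ℂˣ) : Prop :=
  ∃ p : MvPolynomial (Option (Fin n × Fin n)) ℂ,
    ∀ H : torus n, (χ H : ℂ) = MvPolynomial.eval (coords (H : GL (Fin n) ℂ)) p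

/-- `T_{>0}`: the elements of the torus on which every character takes a positive real value. -/
def torusPos (n : ℕ) : Set (GL (Fin n) ℂ) :=
  {A | ∃ H : torus n, (H : GL (Fin n) ℂ) = A ∧
    ∀ χ : torus n →* ℂˣ, IsAlgebraicCharacter χ → ∃ x : ℝ, 0 < x ∧ (χ H : ℂ) = (x : ℂ)}

/-- The Chevalley generators `E_i`, `1 ≤ i ≤ k = ⌊n/2⌋`, of the Lie algebra of `G(Ω_n)`:
`E_{i,i+1} + E_{n-i,n-i+1}` for `i < k`; for `i = k` it is `E_{k,k+1}` if `n = 2k`, and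
`√2 (E_{k,k+1} + E_{k+1,k+2})` if `n = 2k + 1`. -/
def chevE (n i : ℕ) : Matrix (Fin n) (Fin n) ℂ :=
  if i < n / 2 then unitMat n i (i + 1) + unitMat n (n - i) (n - i + 1)
  else if Even n then unitMat n i (i + 1)
  else ((Real.sqrt 2 : ℝ) : ℂ) • (unitMat n i (i + 1) + unitMat n (i + 1) (i + 2))

/-- The Chevalley generators `F_i = E_iᵗ`. -/
def chevF (n i : ℕ) : Matrix (Fin n) (Fin n) ℂ := (chevE n i)ᵀ

/-- The matrix exponential as an element of `GL_n(ℂ)`. -/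
def expGL {n : ℕ} (M : Matrix (Fin n) (Fin n) ℂ) : GL (Fin n) ℂ :=
  (Matrix.isUnit_exp M).unit

/-- The totally nonnegative part `G_{≥0}(Ω_n)`: the submonoid generated by `T_{>0}` and by
`exp(t E_i)`, `exp(t F_i)` for `1 ≤ i ≤ ⌊n/2⌋` and real `t > 0`. -/
def GOmegaNonneg (n : ℕ) : Submonoid (GL (Fin n) ℂ) :=
  Submonoid.closure (torusPos n ∪
    {A | ∃ i : ℕ, 1 ≤ i ∧ i ≤ n / 2 ∧ ∃ t : ℝ, 0 < t ∧
      (A = expGL ((t : ℂ) • chevE n i) ∨ A = expGL ((t : ℂ) • chevF n i))})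

end

end TotalPos

namespace TotalPos

open Matrix

/-! The easy inclusion holds because every generator lies in the group and, acting by right
multiplication, adds nonnegative multiples of columns to adjacent columns or rescales columns by
positive numbers. Such operations keep nonnegative all minors with a given choice of rows
(`PreservesMinors`).

For the converse, an invertible totally nonnegative matrix is real and has a Gauss decomposition `L
* diagonal d * U` with `d > 0` (`RealTNN.exists_ldu`). Uniqueness of this decomposition puts all
three factors in the group (`IsDual.ldu`). The diagonal factor lies in `T_{>0}`: on a real
one-parameter subgroup, an algebraic character is a single real exponential by independence of
characters. Since `Lᵀ` is of the same kind as `U`, only upper unipotent matrices remain.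

These are factored by clearing columns from right to left and each column from top to bottom. The
invariant is nonnegativity of the minors on initial rows (`InitNonneg`), which survives subtracting
the right multiple of the next row (`InitNonneg.elemU_mul`). Inside the group a simple root requires
one, two or three such operations, and after the first ones the matrix leaves the group. The
invariant is then carried across by the involution of `GL_n` defining the group
(`InitNonneg.of_isDual`). For the middle root of odd `n`, isotropy of the column being cleared
forces the parameters to agree (`selfDual_induction`). -/

/-! ### Minors under right multiplication -/

/-- All minors of `M` with the fixed row selection `r` are nonnegative. -/
def RowMinorsNonneg {n m : ℕ} (r : Fin m → Fin n) (M : Matrix (Fin n) (Fin n) ℝ) : Prop :=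
  ∀ f : Fin m ↪o Fin n, 0 ≤ (M.submatrix r f).det

/-- All minors of `M` with an initial set of rows are nonnegative. -/
def InitNonneg {n : ℕ} (M : Matrix (Fin n) (Fin n) ℝ) : Prop :=
  ∀ (m : ℕ) (hm : m ≤ n), RowMinorsNonneg (Fin.castLE hm) M

/-- Total nonnegativity of real matrices. -/
def RealTNN {n : ℕ} (M : Matrix (Fin n) (Fin n) ℝ) : Prop :=
  ∀ (m : ℕ) (r : Fin m ↪o Fin n), RowMinorsNonneg r M

/-- Right multiplication by `V` preserves the nonnegativity of minors, for each choice of rows. -/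
def PreservesMinors {n : ℕ} (V : Matrix (Fin n) (Fin n) ℝ) : Prop :=
  ∀ (m : ℕ) (r : Fin m → Fin n) (M : Matrix (Fin n) (Fin n) ℝ),
    RowMinorsNonneg r M → RowMinorsNonneg r (M * V)

theorem PreservesMinors.one {n : ℕ} : PreservesMinors (1 : Matrix (Fin n) (Fin n) ℝ) := by
  intro m r M h
  rwa [mul_one]

theorem PreservesMinors.mul {n : ℕ} {V W : Matrix (Fin n) (Fin n) ℝ}
    (hV : PreservesMinors V) (hW : PreservesMinors W) : PreservesMinors (V * W) := by
  intro m r M h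
  rw [← mul_assoc]
  exact hW m r _ (hV m r M h)

theorem rowMinorsNonneg_one {n m : ℕ} (r : Fin m ↪o Fin n) :
    RowMinorsNonneg r (1 : Matrix (Fin n) (Fin n) ℝ) := by
  intro f
  by_cases h : ∃ a, r a ∉ Set.range f
  · obtain ⟨a, ha⟩ := h
    rw [det_eq_zero_of_row_eq_zero a]
    intro b
    exact one_apply_ne fun hab => ha ⟨b, hab.symm⟩
  · push Not at h
    have hsub : Set.range r ⊆ Set.range f := by
      rintro _ ⟨a, rfl⟩
      exact h a
    have heq : Set.range r = Set.range f := by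
      apply Set.eq_of_subset_of_ncard_le hsub
      · rw [← Set.image_univ, ← Set.image_univ, Set.ncard_image_of_injective _ r.injective,
          Set.ncard_image_of_injective _ f.injective]
    have hrf : (r : Fin m → Fin n) = f := (StrictMono.range_inj r.strictMono f.strictMono).1 heq
    rw [← hrf, submatrix_one _ r.injective, det_one]
    exact zero_le_one

/-- Apply the preservation property to `M = 1`. Since `PreservesMinors` is closed under products by
associativity, this gives total nonnegativity of products without the Cauchy–Binet formula. -/
theorem PreservesMinors.realTNN {n : ℕ} {V : Matrix (Fin n) (Fin n) ℝ}
    (hV : PreservesMinors V) : RealTNN V := by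
  intro m r
  simpa using hV m r 1 (rowMinorsNonneg_one r)

theorem RealTNN.initNonneg {n : ℕ} {M : Matrix (Fin n) (Fin n) ℝ} (h : RealTNN M) :
    InitNonneg M := fun m hm => h m (Fin.castLEOrderEmb hm)

/-- By linearity in column `q`, a minor gains `t` times the determinant with column `p` in place of
`q`. Either `p` was already selected and this vanishes, or adjacency of `p` and `q` keeps the
selection increasing, so it is again a minor of `M`. -/
theorem preservesMinors_transvection {n : ℕ} {p q : Fin n}
    (hpq : (p : ℕ) + 1 = q ∨ (q : ℕ) + 1 = p) {t : ℝ} (ht : 0 ≤ t) :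
    PreservesMinors (transvection p q t) := by
  intro m r M h f
  by_cases hq : ∃ k, f k = q
  · obtain ⟨k, hk⟩ := hq
    have key : (M * transvection p q t).submatrix r f =
        (M.submatrix r f).updateCol k
          ((fun a => M.submatrix r f a k) + t • fun a => M (r a) p) := by
      ext a b
      by_cases hb : b = k
      · subst hb
        simp [hk]
      · have : f b ≠ q := fun hfb => hb (f.injective (hfb.trans hk.symm))
        simp [hb, mul_transvection_apply_of_ne _ _ _ _ this]
    rw [key, det_updateCol_add, updateCol_eq_self, det_updateCol_smul]
    refine add_nonneg (h f) (mul_nonneg ht ?_)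
    have hsub : (M.submatrix r f).updateCol k (fun a => M (r a) p) =
        M.submatrix r (Function.update f k p) := by
      ext a b
      by_cases hb : b = k
      · subst hb
        simp
      · simp [hb]
    rw [hsub]
    by_cases hp : ∃ l, f l = p
    · obtain ⟨l, hl⟩ := hp
      have hlk : l ≠ k := by
        rintro rfl
        rw [hl] at hk
        subst hk
        omega
      refine le_of_eq (det_zero_of_column_eq hlk fun a => ?_).symm
      simp [hlk, hl]
    · push Not at hp
      have hmono : StrictMono (Function.update f k p) := by
        intro a b hab
        have hab' : (f a : ℕ) < f b := f.strictMono hab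
        have h1 : (f a : ℕ) ≠ p := fun h => hp a (Fin.ext h)
        have h2 : (f b : ℕ) ≠ p := fun h => hp b (Fin.ext h)
        have hk' : (f k : ℕ) = q := by rw [hk]
        rw [Fin.lt_def]
        by_cases ha : a = k
        · subst ha
          have hb : b ≠ a := hab.ne'
          simp only [Function.update_self, Function.update_of_ne hb]
          omega
        · by_cases hb : b = k
          · subst hb
            simp only [Function.update_self, Function.update_of_ne ha]
            omega
          · simp only [Function.update_of_ne ha, Function.update_of_ne hb]
            exact hab'
      exact h (OrderEmbedding.ofStrictMono _ hmono)
  · push Not at hq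
    have key : (M * transvection p q t).submatrix r f = M.submatrix r f := by
      ext a b
      simp [mul_transvection_apply_of_ne _ _ _ _ (hq b)]
    rw [key]
    exact h f

theorem preservesMinors_diagonal {n : ℕ} {d : Fin n → ℝ} (hd : ∀ i, 0 ≤ d i) :
    PreservesMinors (diagonal d) := by
  intro m r M h f
  have key : (M * diagonal d).submatrix r f =
      of fun a b => (d (f b)) * (M.submatrix r f) a b := by
    ext a b
    simp [mul_comm]
  rw [key, det_mul_row]
  exact mul_nonneg (Finset.prod_nonneg fun i _ => hd _) (h f)

/-! ### Elementary unipotent matrices -/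

/-- The superdiagonal matrix unit, in indices starting from `0`; it is zero when out of range. -/
def superUnit (n i : ℕ) : Matrix (Fin n) (Fin n) ℝ :=
  of fun a b => if (a : ℕ) = i ∧ (b : ℕ) = i + 1 then 1 else 0

/-- The elementary unipotent matrix `1 + t e_{i,i+1}`. -/
def elemU (n i : ℕ) (t : ℝ) : Matrix (Fin n) (Fin n) ℝ := 1 + t • superUnit n i

theorem superUnit_eq_zero {n i : ℕ} (h : n ≤ i + 1) : superUnit n i = 0 := by
  ext a b
  have : (b : ℕ) ≠ i + 1 := by omega
  simp [superUnit, this]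

theorem superUnit_mul_apply_of_ne {n i : ℕ} (M : Matrix (Fin n) (Fin n) ℝ) {a : Fin n}
    (ha : (a : ℕ) ≠ i) (b : Fin n) : (superUnit n i * M) a b = 0 := by
  simp [mul_apply, superUnit, ha]

theorem superUnit_mul_apply {n : ℕ} (M : Matrix (Fin n) (Fin n) ℝ) {a a' : Fin n}
    (ha : (a' : ℕ) = a + 1) (b : Fin n) : (superUnit n a * M) a b = M a' b := by
  rw [mul_apply, Finset.sum_eq_single a']
  · simp [superUnit, ha]
  · intro x _ hx
    have : (x : ℕ) ≠ a + 1 := fun h => hx (Fin.ext (h.trans ha.symm))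
    simp [superUnit, this]
  · simp

theorem elemU_mul_apply_of_ne {n i : ℕ} (t : ℝ) (M : Matrix (Fin n) (Fin n) ℝ) {a : Fin n}
    (ha : (a : ℕ) ≠ i) (b : Fin n) : (elemU n i t * M) a b = M a b := by
  simp [elemU, add_mul, superUnit_mul_apply_of_ne M ha]

theorem elemU_mul_apply {n : ℕ} (t : ℝ) (M : Matrix (Fin n) (Fin n) ℝ) {a a' : Fin n}
    (ha : (a' : ℕ) = a + 1) (b : Fin n) : (elemU n a t * M) a b = M a b + t * M a' b := by
  simp [elemU, add_mul, superUnit_mul_apply M ha]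

theorem superUnit_mul_superUnit {n i j : ℕ} (h : j ≠ i + 1) :
    superUnit n i * superUnit n j = 0 := by
  ext a b
  by_cases ha : (a : ℕ) = i
  · rw [mul_apply]
    refine Finset.sum_eq_zero fun x _ => ?_
    by_cases hx : (x : ℕ) = i + 1
    · simp [superUnit, hx, h.symm]
    · simp [superUnit, hx]
  · rw [superUnit_mul_apply_of_ne _ ha]
    rfl

theorem elemU_mul_elemU {n i : ℕ} (s t : ℝ) : elemU n i s * elemU n i t = elemU n i (s + t) := by
  have h : superUnit n i * superUnit n i = 0 := superUnit_mul_superUnit (by omega)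
  simp only [elemU, add_mul, mul_add, one_mul, mul_one, smul_mul_assoc, mul_smul_comm, h,
    smul_zero, add_zero, add_smul]
  abel

theorem elemU_zero {n i : ℕ} : elemU n i 0 = 1 := by simp [elemU]

theorem elemU_mul_neg {n i : ℕ} (t : ℝ) : elemU n i t * elemU n i (-t) = 1 := by
  rw [elemU_mul_elemU, add_neg_cancel, elemU_zero]

theorem elemU_eq_transvection {n : ℕ} {a a' : Fin n} (ha : (a' : ℕ) = a + 1) (t : ℝ) :
    elemU n a t = transvection a a' t := by
  ext x y
  rw [elemU, transvection, Matrix.add_apply, Matrix.add_apply, Matrix.smul_apply, single_apply]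
  simp [superUnit, Fin.ext_iff, ha, eq_comm]

theorem preservesMinors_elemU (n i : ℕ) {t : ℝ} (ht : 0 ≤ t) : PreservesMinors (elemU n i t) := by
  by_cases hi : i + 1 < n
  · rw [show elemU n i t = _ from
      elemU_eq_transvection (a := ⟨i, by omega⟩) (a' := ⟨i + 1, hi⟩) rfl t]
    exact preservesMinors_transvection (Or.inl rfl) ht
  · rw [elemU, superUnit_eq_zero (by omega), smul_zero, add_zero]
    exact PreservesMinors.one

theorem preservesMinors_elemU_transpose (n i : ℕ) {t : ℝ} (ht : 0 ≤ t) :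
    PreservesMinors (elemU n i t)ᵀ := by
  by_cases hi : i + 1 < n
  · rw [show elemU n i t = _ from
      elemU_eq_transvection (a := ⟨i, by omega⟩) (a' := ⟨i + 1, hi⟩) rfl t]
    have : (transvection (⟨i, by omega⟩ : Fin n) ⟨i + 1, hi⟩ t)ᵀ =
        transvection ⟨i + 1, hi⟩ ⟨i, by omega⟩ t := by
      simp [transvection]
    rw [this]
    exact preservesMinors_transvection (Or.inr rfl) ht
  · rw [elemU, superUnit_eq_zero (by omega), smul_zero, add_zero, transpose_one]
    exact PreservesMinors.one

/-! ### Clearing columns of unipotent matrices -/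

/-- Upper triangular matrices with unit diagonal. -/
def IsUpperUnipotent {n : ℕ} (U : Matrix (Fin n) (Fin n) ℝ) : Prop :=
  (∀ a b, b < a → U a b = 0) ∧ ∀ a, U a a = 1

theorem IsUpperUnipotent.elemU_mul {n : ℕ} {U : Matrix (Fin n) (Fin n) ℝ}
    (hU : IsUpperUnipotent U) (i : ℕ) (t : ℝ) : IsUpperUnipotent (elemU n i t * U) := by
  have key : ∀ a b, b ≤ a → (elemU n i t * U) a b = U a b := by
    intro a b hab
    by_cases ha : (a : ℕ) = i
    · by_cases hi : i + 1 < n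
      · subst ha
        have : (b : ℕ) ≤ a := hab
        rw [elemU_mul_apply t U (a' := ⟨a + 1, hi⟩) rfl,
          hU.1 ⟨a + 1, hi⟩ b (by rw [Fin.lt_def]; simp only; omega), mul_zero, add_zero]
      · rw [elemU, superUnit_eq_zero (by omega), smul_zero, add_zero, one_mul]
    · exact elemU_mul_apply_of_ne t U ha b
  exact ⟨fun a b hab => by rw [key a b hab.le, hU.1 a b hab],
    fun a => by rw [key a a le_rfl, hU.2]⟩

/-- Adjoining a last element to an order embedding of `Fin m`. -/
def snocEmb {n m : ℕ} (f : Fin m ↪o Fin n) (c : Fin n) (h : ∀ k, f k < c) :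
    Fin (m + 1) ↪o Fin n :=
  OrderEmbedding.ofStrictMono (Fin.snoc (α := fun _ => Fin n) f c) (by
    intro a b hab
    induction b using Fin.lastCases with
    | last =>
      induction a using Fin.lastCases with
      | last => exact absurd hab (lt_irrefl _)
      | cast a => simpa using h a
    | cast b =>
      induction a using Fin.lastCases with
      | last => exact absurd hab (not_lt.2 (Fin.le_last _))
      | cast a => simpa using hab)

@[simp]
theorem snocEmb_castSucc {n m : ℕ} (f : Fin m ↪o Fin n) (c : Fin n) (h : ∀ k, f k < c)
    (k : Fin m) : snocEmb f c h k.castSucc = f k :=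
  Fin.snoc_castSucc (α := fun _ => Fin n) c f k

@[simp]
theorem snocEmb_last {n m : ℕ} (f : Fin m ↪o Fin n) (c : Fin n) (h : ∀ k, f k < c) :
    snocEmb f c h (Fin.last m) = c :=
  Fin.snoc_last (α := fun _ => Fin n) c f

theorem det_eq_of_last_column {m : ℕ} (A : Matrix (Fin (m + 1)) (Fin (m + 1)) ℝ) (j : Fin (m + 1))
    (h : ∀ a, a ≠ j → A a (Fin.last m) = 0) :
    A.det = (-1) ^ (j + m : ℕ) * A j (Fin.last m) *
      (A.submatrix j.succAbove Fin.castSucc).det := by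
  rw [det_succ_column A (Fin.last m), Finset.sum_eq_single j]
  · simp
  · intro a _ ha
    rw [h a ha, mul_zero, zero_mul]
  · simp

/-- If the first nonzero entry in the last nontrivial column `c` is in row `i`, then it can be
cleared by a row operation that preserves the nonnegativity of the initial minors. -/
theorem InitNonneg.elemU_mul {n : ℕ} {U : Matrix (Fin n) (Fin n) ℝ} (hQ : InitNonneg U)
    {i i' c : Fin n} (hi : (i' : ℕ) = i + 1) (hic : i < c)
    (htriv : ∀ d, c < d → ∀ a, a ≠ d → U a d = 0) (hz : ∀ a, a < i → U a c = 0)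
    (hpos : 0 < U i' c) {t : ℝ} (ht : U i c = t * U i' c) :
    InitNonneg (elemU n i (-t) * U) := by
  have hic' : (i : ℕ) < c := hic
  -- Minors containing both rows `i` and `i'` are unchanged by the row operation. Only `m = i + 1`,
  -- where row `i` is present without row `i'`, needs an argument.
  have hlarge : ∀ (m : ℕ) (hm : m ≤ n), (i' : ℕ) < m → ∀ f : Fin m ↪o Fin n,
      0 ≤ ((elemU n i (-t) * U).submatrix (Fin.castLE hm) f).det := by
    intro m hm him f
    have key : (elemU n i (-t) * U).submatrix (Fin.castLE hm) f =
        (U.submatrix (Fin.castLE hm) f).updateRow ⟨i, by omega⟩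
          ((U.submatrix (Fin.castLE hm) f) ⟨i, by omega⟩ +
            (-t) • (U.submatrix (Fin.castLE hm) f) ⟨i', him⟩) := by
      ext a b
      by_cases ha : a = ⟨i, by omega⟩
      · subst ha
        rw [updateRow_self, submatrix_apply]
        exact elemU_mul_apply (-t) U hi (f b)
      · rw [updateRow_ne ha, submatrix_apply, submatrix_apply, elemU_mul_apply_of_ne]
        exact fun h => ha (Fin.ext h)
    rw [key, det_updateRow_add_smul_self _ (by simp [Fin.ext_iff]; omega)]
    exact hQ m hm f
  intro m hm f
  rcases lt_trichotomy m (i + 1) with hlt | heq | hgt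
  · have key : (elemU n i (-t) * U).submatrix (Fin.castLE hm) f =
        U.submatrix (Fin.castLE hm) f := by
      ext a b
      rw [submatrix_apply, submatrix_apply, elemU_mul_apply_of_ne]
      simp only [Fin.val_castLE]
      omega
    rw [key]
    exact hQ m hm f
  -- A selected column at or beyond `c` vanishes in rows up to `i`. Otherwise the minor is bordered
  -- by row `i'` and column `c`; the new last column is zero except for `U i' c > 0`, so the larger
  -- nonnegative minor is the wanted one times a positive number.
  · by_cases hf : ∃ k, c ≤ f k
    · obtain ⟨k, hk⟩ := hf
      refine le_of_eq (det_eq_zero_of_column_eq_zero k fun a => ?_).symm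
      have hk' : (c : ℕ) ≤ f k := hk
      rw [submatrix_apply]
      have ha : (Fin.castLE hm a : ℕ) ≤ i := by
        simp only [Fin.val_castLE]
        omega
      generalize Fin.castLE hm a = a at ha
      rcases hk.eq_or_lt with hck | hck
      · rw [← hck]
        by_cases hai : (a : ℕ) = i
        · obtain rfl : a = i := Fin.ext hai
          rw [elemU_mul_apply _ _ hi, ht]
          ring
        · rw [elemU_mul_apply_of_ne _ _ hai, hz a (by rw [Fin.lt_def]; omega)]
      · have hck' : (c : ℕ) < f k := hck
        have hne : ∀ b : Fin n, (b : ℕ) ≤ i' → U b (f k) = 0 := by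
          intro b hb
          refine htriv _ hck b fun h => ?_
          rw [h] at hb
          omega
        by_cases hai : (a : ℕ) = i
        · obtain rfl : a = i := Fin.ext hai
          rw [elemU_mul_apply _ _ hi, hne _ (by omega), hne _ le_rfl, mul_zero, add_zero]
        · rw [elemU_mul_apply_of_ne _ _ hai, hne a (by omega)]
    · push Not at hf
      have hm' : m + 1 ≤ n := by omega
      have hdet := hlarge (m + 1) hm' (by omega) (snocEmb f c hf)
      rw [det_eq_of_last_column _ (Fin.last m)] at hdet
      · have e1 : ((elemU n i (-t) * U).submatrix (Fin.castLE hm') (snocEmb f c hf)).submatrix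
            (Fin.last m).succAbove Fin.castSucc =
            (elemU n i (-t) * U).submatrix (Fin.castLE hm) f := by
          ext a b
          simp only [submatrix_apply, snocEmb_castSucc, Fin.succAbove_last]
          rfl
        have e2 : Fin.castLE hm' (Fin.last m) = i' := by
          ext
          simp only [Fin.val_castLE, Fin.val_last]
          omega
        rw [e1, submatrix_apply, snocEmb_last, e2, elemU_mul_apply_of_ne _ _ (by omega),
          Fin.val_last, ← two_mul, pow_mul] at hdet
        simp only [even_two, Even.neg_pow, one_pow, one_mul] at hdet
        exact nonneg_of_mul_nonneg_right hdet hpos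
      · intro a ha
        rw [submatrix_apply, snocEmb_last]
        have ha : (Fin.castLE hm' a : ℕ) ≤ i := by
          simp only [Fin.val_castLE]
          have := Fin.val_lt_last ha
          omega
        generalize Fin.castLE hm' a = a at ha
        by_cases hai : (a : ℕ) = i
        · obtain rfl : a = i := Fin.ext hai
          rw [elemU_mul_apply _ _ hi, ht]
          ring
        · rw [elemU_mul_apply_of_ne _ _ hai, hz a (by rw [Fin.lt_def]; omega)]
  · exact hlarge m hm (by omega) f

theorem IsUpperUnipotent.det_submatrix {n m : ℕ} {U : Matrix (Fin n) (Fin n) ℝ}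
    (hU : IsUpperUnipotent U) (f : Fin m ↪o Fin n) : (U.submatrix f f).det = 1 := by
  rw [det_of_isUpperTriangular]
  · simp [hU.2]
  · intro a b hab
    exact hU.1 _ _ (f.strictMono hab)

/-- Above the diagonal, the entry is itself an initial minor: rows `0, …, i` and columns `0, …, i -
1, c` form a triangular matrix with diagonal `1, …, 1, U i c`. -/
theorem IsUpperUnipotent.apply_nonneg {n : ℕ} {U : Matrix (Fin n) (Fin n) ℝ}
    (hU : IsUpperUnipotent U) (hQ : InitNonneg U) (i c : Fin n) : 0 ≤ U i c := by
  rcases lt_trichotomy i c with hic | rfl | hci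
  · have hic' : (i : ℕ) < c := hic
    have h := hQ (i + 1) (by omega) (snocEmb (Fin.castLEOrderEmb (by omega)) c (by
      intro k
      rw [Fin.lt_def]
      simp only [Fin.castLEOrderEmb_apply, Fin.val_castLE]
      omega))
    rw [det_of_isUpperTriangular] at h
    · rw [Fin.prod_univ_castSucc, Finset.prod_eq_one, one_mul, submatrix_apply,
        snocEmb_last] at h
      · exact h
      · intro a _
        rw [submatrix_apply, snocEmb_castSucc]
        exact hU.2 _
    · intro a b hab
      have hab : b < a := hab
      obtain ⟨b, rfl⟩ := Fin.exists_castSucc_eq.2 (ne_of_lt (hab.trans_le (Fin.le_last _)))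
      rw [submatrix_apply, snocEmb_castSucc]
      exact hU.1 _ _ hab
  · rw [hU.2]
    exact zero_le_one
  · rw [hU.1 _ _ hci]

/-- If `U i' c` vanished with `i' < c`, the initial minor on rows `0, …, i + 1` and columns `0, …, i
- 1, i + 1, c` would have `U i c` as the only nonzero entry of its last column. Expansion gives `-U
i c < 0`, a contradiction. -/
theorem IsUpperUnipotent.apply_succ_pos {n : ℕ} {U : Matrix (Fin n) (Fin n) ℝ}
    (hU : IsUpperUnipotent U) (hQ : InitNonneg U) {i i' c : Fin n} (hi : (i' : ℕ) = i + 1)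
    (hic : i < c) (hz : ∀ a, a < i → U a c = 0) (h0 : U i c ≠ 0) : 0 < U i' c := by
  have hpos : 0 < U i c := (hU.apply_nonneg hQ i c).lt_of_ne' h0
  have hic' : (i : ℕ) < c := hic
  by_cases hc : i' = c
  · rw [hc, hU.2]
    exact zero_lt_one
  refine (hU.apply_nonneg hQ i' c).lt_of_ne' fun hzero => ?_
  have hc' : (i' : ℕ) ≠ c := fun h => hc (Fin.ext h)
  let f : Fin (i + 1) ↪o Fin n := snocEmb (Fin.castLEOrderEmb (by omega)) i' (by
      intro k
      rw [Fin.lt_def]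
      simp only [Fin.castLEOrderEmb_apply, Fin.val_castLE]
      omega)
  have hfc : ∀ k, f k < c := by
    intro k
    rw [Fin.lt_def]
    induction k using Fin.lastCases with
    | last =>
      simp only [f, snocEmb_last]
      omega
    | cast k =>
      simp only [f, snocEmb_castSucc, Fin.castLEOrderEmb_apply, Fin.val_castLE]
      omega
  have h := hQ (i + 1 + 1) (by omega) (snocEmb f c hfc)
  rw [det_eq_of_last_column _ (Fin.last i).castSucc] at h
  · have e : (U.submatrix (Fin.castLE (by omega)) (snocEmb f c hfc)).submatrix
        (Fin.last i).castSucc.succAbove Fin.castSucc = U.submatrix f f := by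
      ext a b
      simp only [submatrix_apply, snocEmb_castSucc]
      congr 1
      induction a using Fin.lastCases with
      | last =>
        ext
        simp only [f, snocEmb_last, Fin.succAbove_castSucc_self]
        simp [hi]
      | cast a =>
        ext
        simp only [f, snocEmb_castSucc]
        rw [Fin.succAbove_of_castSucc_lt _ _ (by simp [Fin.lt_def])]
        simp
    have e2 : Fin.castLE (by omega : (i : ℕ) + 1 + 1 ≤ n) (Fin.last (i : ℕ)).castSucc = i := by
      ext
      simp
    rw [e, hU.det_submatrix, submatrix_apply, snocEmb_last, e2, mul_one] at h
    have e3 : ((-1 : ℝ)) ^ (((Fin.last (i : ℕ)).castSucc : ℕ) + (i + 1)) = -1 := by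
      simp only [Fin.val_castSucc, Fin.val_last]
      exact Odd.neg_one_pow ⟨i, by ring⟩
    rw [e3] at h
    linarith
  · intro a ha
    rw [submatrix_apply, snocEmb_last]
    have hane : (a : ℕ) ≠ i := fun h => ha (Fin.ext h)
    by_cases hai : (a : ℕ) < i
    · exact hz _ hai
    · have : Fin.castLE (by omega : (i : ℕ) + 1 + 1 ≤ n) a = i' := by
        ext
        simp only [Fin.val_castLE]
        omega
      rw [this, hzero]

/-- Induction over unipotent matrices by clearing the columns from right to left and each of them
from top to bottom. -/
theorem upperUnipotent_induction {n : ℕ} {P C : Matrix (Fin n) (Fin n) ℝ → Prop}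
    (hP : ∀ U, P U → IsUpperUnipotent U) (one : C 1)
    (step : ∀ U (i c : Fin n), P U → i < c → (∀ d, c < d → ∀ a, a ≠ d → U a d = 0) →
      (∀ a, a < i → U a c = 0) → U i c ≠ 0 →
      ∃ U', P U' ∧ (∀ d, c < d → ∀ a, a ≠ d → U' a d = 0) ∧ (∀ a, a ≤ i → U' a c = 0) ∧
        (C U' → C U)) :
    ∀ U, P U → C U := by
  have main : ∀ (c : ℕ) (U : Matrix (Fin n) (Fin n) ℝ), P U →
      (∀ d : Fin n, c ≤ d → ∀ a, a ≠ d → U a d = 0) → C U := by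
    intro c
    induction c with
    | zero =>
      intro U hU h
      have : U = 1 := by
        ext a b
        by_cases hab : a = b
        · rw [hab, one_apply_eq, (hP U hU).2]
        · rw [one_apply_ne hab, h b (Nat.zero_le _) a hab]
      rwa [this]
    | succ c ih =>
      intro U hU h
      by_cases hc : c < n
      -- Here `j` bounds the number of entries above the diagonal of column `c` not yet known to
      -- vanish; the next one lies in row `c - (j + 1)`. For `j = c` the condition is vacuous.
      · have inner : ∀ (j : ℕ) (U : Matrix (Fin n) (Fin n) ℝ), P U →
            (∀ d : Fin n, c + 1 ≤ d → ∀ a, a ≠ d → U a d = 0) →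
            (∀ a : Fin n, (a : ℕ) + j < c → U a ⟨c, hc⟩ = 0) → C U := by
          intro j
          induction j with
          | zero =>
            intro U hU h h0
            refine ih U hU fun d hd a had => ?_
            rcases hd.eq_or_lt with hd | hd
            · obtain rfl : d = ⟨c, hc⟩ := Fin.ext hd.symm
              rcases lt_or_gt_of_ne had with had | had
              · exact h0 a had
              · exact (hP U hU).1 _ _ had
            · exact h d hd a had
          | succ j ihj =>
            intro U hU h h0
            by_cases hj : j + 1 ≤ c
            · by_cases hzero : U ⟨c - (j + 1), by omega⟩ ⟨c, hc⟩ = 0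
              · refine ihj U hU h fun a ha => ?_
                by_cases haj : (a : ℕ) + (j + 1) < c
                · exact h0 a haj
                · rw [← hzero]
                  congr 1
                  ext
                  simp only
                  omega
              · obtain ⟨U', hU', h1, h2, h3⟩ := step U ⟨c - (j + 1), by omega⟩ ⟨c, hc⟩ hU
                  (by rw [Fin.lt_def]; simp only; omega) (fun d hd => h d hd)
                  (fun a ha => h0 a (by rw [Fin.lt_def] at ha; simp only at ha; omega)) hzero
                refine h3 (ihj U' hU' (fun d hd => h1 d hd) fun a ha => h2 a ?_)
                rw [Fin.le_def]
                simp only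
                omega
            · exact ihj U hU h fun a ha => by omega
        exact inner c U hU h fun a ha => by omega
      · exact ih U hU fun d hd => by omega
  intro U hU
  exact main n U hU fun d hd => by omega

/-! ### The form and the involution it defines -/

/-- The form `Omega` with real entries. -/
def OmegaReal (n : ℕ) : Matrix (Fin n) (Fin n) ℝ :=
  of fun a b => if (a : ℕ) + b + 1 = n then (-1) ^ (a : ℕ) else 0

theorem OmegaReal_apply {n : ℕ} (a b : Fin n) :
    OmegaReal n a b = if b = a.rev then (-1) ^ (a : ℕ) else 0 := by
  have : (a : ℕ) + b + 1 = n ↔ b = a.rev := by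
    rw [Fin.ext_iff, Fin.val_rev]
    omega
  simp only [OmegaReal, of_apply, this]

theorem OmegaReal_mul_apply {n : ℕ} (M : Matrix (Fin n) (Fin n) ℝ) (a b : Fin n) :
    (OmegaReal n * M) a b = (-1) ^ (a : ℕ) * M a.rev b := by
  simp [mul_apply, OmegaReal_apply]

theorem mul_OmegaReal_apply {n : ℕ} (M : Matrix (Fin n) (Fin n) ℝ) (a b : Fin n) :
    (M * OmegaReal n) a b = (-1) ^ (b.rev : ℕ) * M a b.rev := by
  rw [mul_apply, Finset.sum_eq_single b.rev]
  · rw [OmegaReal_apply, if_pos (by simp), mul_comm]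
  · intro x _ hx
    rw [OmegaReal_apply, if_neg (fun h => hx (by rw [h, Fin.rev_rev])), mul_zero]
  · simp

theorem OmegaReal_mul_transpose (n : ℕ) : OmegaReal n * (OmegaReal n)ᵀ = 1 := by
  ext a b
  rw [OmegaReal_mul_apply, transpose_apply, OmegaReal_apply, one_apply]
  by_cases h : a = b
  · subst h
    simp [← pow_add, ← two_mul]
  · rw [if_neg (fun h' => h (Fin.rev_injective h')), if_neg h, mul_zero]

theorem OmegaReal_transpose_mul (n : ℕ) : (OmegaReal n)ᵀ * OmegaReal n = 1 :=
  mul_eq_one_comm.1 (OmegaReal_mul_transpose n)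

/-- `V` is the image of `U` under the involution of `GL_n` whose group of fixed points is the
group of the form `Omega`. -/
def IsDual {n : ℕ} (V U : Matrix (Fin n) (Fin n) ℝ) : Prop :=
  V * OmegaReal n * Uᵀ = OmegaReal n

theorem IsDual.one {n : ℕ} : IsDual (1 : Matrix (Fin n) (Fin n) ℝ) 1 := by
  simp [IsDual]

theorem IsDual.mul {n : ℕ} {V U V' U' : Matrix (Fin n) (Fin n) ℝ} (h : IsDual V U)
    (h' : IsDual V' U') : IsDual (V * V') (U * U') := by
  unfold IsDual at *
  calc V * V' * OmegaReal n * (U * U')ᵀ = V * (V' * OmegaReal n * U'ᵀ) * Uᵀ := by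
        rw [transpose_mul]
        simp only [Matrix.mul_assoc]
    _ = OmegaReal n := by rw [h', h]

/-- Self-duality says that `Ω Uᵀ Ωᵀ` is a right inverse of `U`. It is then also a left inverse, and
cancelling `Ω` and transposing gives the claim. -/
theorem IsDual.transpose {n : ℕ} {U : Matrix (Fin n) (Fin n) ℝ} (h : IsDual U U) :
    IsDual Uᵀ Uᵀ := by
  unfold IsDual at *
  rw [transpose_transpose]
  have h1 : U * (OmegaReal n * Uᵀ * (OmegaReal n)ᵀ) = 1 := by
    rw [← Matrix.mul_assoc, ← Matrix.mul_assoc, h, OmegaReal_mul_transpose]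
  have h2 := mul_eq_one_comm.1 h1
  have h3 : Uᵀ * (OmegaReal n)ᵀ * U = (OmegaReal n)ᵀ := by
    calc Uᵀ * (OmegaReal n)ᵀ * U
        = ((OmegaReal n)ᵀ * OmegaReal n) * (Uᵀ * (OmegaReal n)ᵀ * U) := by
          rw [OmegaReal_transpose_mul, Matrix.one_mul]
      _ = (OmegaReal n)ᵀ * (OmegaReal n * Uᵀ * (OmegaReal n)ᵀ * U) := by
          simp only [Matrix.mul_assoc]
      _ = (OmegaReal n)ᵀ := by rw [h2, Matrix.mul_one]
  have h4 := congrArg Matrix.transpose h3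
  rw [transpose_mul, transpose_mul, transpose_transpose, transpose_transpose] at h4
  rw [Matrix.mul_assoc]
  exact h4

theorem IsUpperUnipotent.det_eq_one {n : ℕ} {U : Matrix (Fin n) (Fin n) ℝ}
    (hU : IsUpperUnipotent U) : U.det = 1 :=
  hU.det_submatrix (RelEmbedding.refl _)

theorem IsDual.left_unique {n : ℕ} {V W U : Matrix (Fin n) (Fin n) ℝ} (h : IsDual V U)
    (h' : IsDual W U) (hU : IsUpperUnipotent U) : V = W := by
  have hu : IsUnit (OmegaReal n * Uᵀ) := by
    refine IsUnit.mul (IsUnit.of_mul_eq_one _ (OmegaReal_mul_transpose n)) ?_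
    rw [isUnit_iff_isUnit_det, det_transpose, hU.det_eq_one]
    exact isUnit_one
  apply hu.mul_right_cancel
  unfold IsDual at *
  rw [← Matrix.mul_assoc, h, ← Matrix.mul_assoc, h']

/-- The alternating signs of `Ω` give `e_{i,i+1} Ω = -Ω e_{j,j+1}ᵀ`, so the involution reflects the
index and keeps the sign of `t`. This is why it respects positivity. -/
theorem isDual_elemU {n i j : ℕ} (h : i + j + 2 = n) (t : ℝ) :
    IsDual (elemU n i t) (elemU n j t) := by
  have h1 : superUnit n i * OmegaReal n + OmegaReal n * (superUnit n j)ᵀ = 0 := by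
    ext a b
    rw [Matrix.add_apply, mul_OmegaReal_apply, OmegaReal_mul_apply, transpose_apply]
    simp only [superUnit, of_apply, Fin.val_rev, Matrix.zero_apply]
    by_cases hab : (a : ℕ) = i ∧ (b : ℕ) = j
    · simp [hab.1, hab.2, show n - (j + 1) = i + 1 by omega, show n - (i + 1) = j + 1 by omega,
        pow_succ]
    · rw [if_neg (by omega), if_neg (by omega)]
      simp
  have h2 : superUnit n i * OmegaReal n * (superUnit n j)ᵀ = 0 := by
    rw [eq_neg_of_add_eq_zero_left h1, Matrix.neg_mul, Matrix.mul_assoc, ← transpose_mul,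
      superUnit_mul_superUnit (by omega), transpose_zero, Matrix.mul_zero, neg_zero]
  unfold IsDual
  rw [elemU, elemU, transpose_add, transpose_one, transpose_smul]
  calc (1 + t • superUnit n i) * OmegaReal n * (1 + t • (superUnit n j)ᵀ)
      = OmegaReal n + t • (superUnit n i * OmegaReal n + OmegaReal n * (superUnit n j)ᵀ) +
          (t * t) • (superUnit n i * OmegaReal n * (superUnit n j)ᵀ) := by
        simp only [add_mul, mul_add, one_mul, mul_one, smul_mul_assoc, mul_smul_comm, smul_add,
          mul_smul]
        abel
    _ = OmegaReal n := by rw [h1, h2, smul_zero, smul_zero, add_zero, add_zero]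

theorem elemU_mul_trivial_column {n : ℕ} {U : Matrix (Fin n) (Fin n) ℝ} {c : Fin n} {i : ℕ}
    (hi : i < c) (t : ℝ) (htriv : ∀ d, c < d → ∀ a, a ≠ d → U a d = 0) :
    ∀ d, c < d → ∀ a, a ≠ d → (elemU n i t * U) a d = 0 := by
  intro d hd a ha
  have hd' : (c : ℕ) < d := hd
  by_cases hai : (a : ℕ) = i
  · subst hai
    rw [elemU_mul_apply t U (a' := ⟨a + 1, by omega⟩) rfl, htriv d hd a ha,
      htriv d hd _ (fun h => by rw [Fin.ext_iff] at h; simp only at h; omega), mul_zero, add_zero]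
  · rw [elemU_mul_apply_of_ne _ _ hai, htriv d hd a ha]

/-- The involution preserves the nonnegativity of initial minors of unipotent matrices. -/
theorem InitNonneg.of_isDual {n : ℕ} {V U : Matrix (Fin n) (Fin n) ℝ} (hQ : InitNonneg U)
    (hU : IsUpperUnipotent U) (h : IsDual V U) : InitNonneg V := by
  -- Initial minors are not directly comparable under the involution. Instead `U` is factored into
  -- elementary matrices with nonnegative parameters, and each factor is replaced by its dual.
  have main : ∀ U : Matrix (Fin n) (Fin n) ℝ, IsUpperUnipotent U ∧ InitNonneg U →
      ∃ V, PreservesMinors V ∧ IsDual V U := by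
    refine upperUnipotent_induction (P := fun U => IsUpperUnipotent U ∧ InitNonneg U)
      (C := fun U => ∃ V, PreservesMinors V ∧ IsDual V U) (fun U h => h.1)
      ⟨1, PreservesMinors.one, IsDual.one⟩ ?_
    rintro U i c ⟨hU, hQ⟩ hic htriv hz h0
    have hic' : (i : ℕ) < c := hic
    obtain ⟨i', hi⟩ : ∃ i' : Fin n, (i' : ℕ) = i + 1 := ⟨⟨i + 1, by omega⟩, rfl⟩
    have hpos := hU.apply_succ_pos hQ hi hic hz h0
    have ht : U i c = U i c / U i' c * U i' c := (div_mul_cancel₀ _ hpos.ne').symm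
    have ht0 : 0 ≤ U i c / U i' c := div_nonneg (hU.apply_nonneg hQ i c) hpos.le
    set t := U i c / U i' c
    refine ⟨elemU n i (-t) * U, ⟨hU.elemU_mul _ _, hQ.elemU_mul hi hic htriv hz hpos ht⟩,
      elemU_mul_trivial_column hic' _ htriv, ?_, ?_⟩
    · intro a ha
      rcases ha.eq_or_lt with rfl | ha
      · rw [elemU_mul_apply _ _ hi, ht]
        ring
      · rw [elemU_mul_apply_of_ne _ _ (fun h => ha.ne (Fin.ext h)), hz a ha]
    · rintro ⟨V, hV, hVU⟩
      refine ⟨elemU n (n - 2 - i) t * V, (preservesMinors_elemU _ _ ht0).mul hV, ?_⟩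
      have := (isDual_elemU (n := n) (i := n - 2 - i) (j := i) (by omega) t).mul hVU
      rwa [← Matrix.mul_assoc (elemU n i t), elemU_mul_neg, Matrix.one_mul] at this
  obtain ⟨W, hW, hWU⟩ := main U ⟨hU, hQ⟩
  rw [h.left_unique hWU hU]
  exact hW.realTNN.initNonneg

/-! ### Factorization of unipotent matrices inside the group -/

theorem elemU_comm {n i j : ℕ} (hij : j ≠ i + 1) (hji : i ≠ j + 1) (s t : ℝ) :
    elemU n i s * elemU n j t = elemU n j t * elemU n i s := by
  simp only [elemU, add_mul, mul_add, one_mul, mul_one, smul_mul_assoc, mul_smul_comm,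
    superUnit_mul_superUnit hij, superUnit_mul_superUnit hji, smul_zero, add_zero]
  abel

/-- The exponential of `s (e_{i,i+1} + e_{i+1,i+2})`. -/
noncomputable def elemMid (n i : ℕ) (s : ℝ) : Matrix (Fin n) (Fin n) ℝ :=
  1 + s • (superUnit n i + superUnit n (i + 1)) +
    (s * s / 2) • (superUnit n i * superUnit n (i + 1))

theorem elemMid_eq_mul (n i : ℕ) (s : ℝ) :
    elemMid n i s = elemU n i (s / 2) * (elemU n (i + 1) s * elemU n i (s / 2)) := by
  have h1 : superUnit n i * superUnit n i = 0 := superUnit_mul_superUnit (by omega)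
  have h2 : superUnit n (i + 1) * superUnit n i = 0 := superUnit_mul_superUnit (by omega)
  simp only [elemU, elemMid, add_mul, mul_add, one_mul, mul_one, smul_mul_assoc, mul_smul_comm,
    smul_zero, add_zero, h1, h2, smul_add, smul_smul]
  module

/-- When `i` and `i + 1` are exchanged by the involution, it turns the word of `elemMid_eq_mul` into
this one; hence `elemMid` is self-dual. -/
theorem elemMid_eq_mul' (n i : ℕ) (s : ℝ) :
    elemMid n i s = elemU n (i + 1) (s / 2) * (elemU n i s * elemU n (i + 1) (s / 2)) := by
  have h1 : superUnit n (i + 1) * superUnit n (i + 1) = 0 := superUnit_mul_superUnit (by omega)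
  have h2 : superUnit n (i + 1) * superUnit n i = 0 := superUnit_mul_superUnit (by omega)
  have h3 : superUnit n (i + 1) * (superUnit n i * superUnit n (i + 1)) = 0 := by
    rw [← mul_assoc, h2, zero_mul]
  simp only [elemU, elemMid, add_mul, mul_add, one_mul, mul_one, smul_mul_assoc, mul_smul_comm,
    smul_zero, add_zero, h1, h2, h3, smul_add, smul_smul]
  module

theorem elemMid_mul_neg (n i : ℕ) (s : ℝ) : elemMid n i s * elemMid n i (-s) = 1 := by
  rw [elemMid_eq_mul n i s, elemMid_eq_mul n i (-s), neg_div]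
  calc elemU n i (s / 2) * (elemU n (i + 1) s * elemU n i (s / 2)) *
        (elemU n i (-(s / 2)) * (elemU n (i + 1) (-s) * elemU n i (-(s / 2))))
      = elemU n i (s / 2) * (elemU n (i + 1) s * (elemU n i (s / 2) * elemU n i (-(s / 2))) *
          elemU n (i + 1) (-s)) * elemU n i (-(s / 2)) := by simp only [mul_assoc]
    _ = 1 := by rw [elemU_mul_neg, mul_one, elemU_mul_neg, mul_one, elemU_mul_neg]

/-- Trivial columns to the right of `c` force trivial rows above `c.rev`: the entry `(b, i.rev)` of
`Uᵀ Ω U = Ω` reduces to `± U i b`. -/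
theorem IsDual.apply_eq_zero {n : ℕ} {U : Matrix (Fin n) (Fin n) ℝ} (h : IsDual U U)
    (hU : IsUpperUnipotent U) {c : Fin n} (htriv : ∀ d, c < d → ∀ a, a ≠ d → U a d = 0)
    {i : Fin n} (hi : i < c.rev) {b : Fin n} (hb : b ≠ i) : U i b = 0 := by
  have h1 := congrFun (congrFun h.transpose b) i.rev
  rw [transpose_transpose, mul_apply, Finset.sum_eq_single i.rev] at h1
  · rw [mul_OmegaReal_apply, hU.2, OmegaReal_apply, Fin.rev_rev, mul_one, transpose_apply,
      if_neg (fun h => hb (Fin.rev_injective h).symm)] at h1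
    exact (mul_eq_zero.1 h1).resolve_left (pow_ne_zero _ (by norm_num))
  · intro x _ hx
    rw [htriv i.rev (by rwa [Fin.lt_rev_iff]) x hx, mul_zero]
  · simp

theorem IsDual.isotropic {n : ℕ} {U : Matrix (Fin n) (Fin n) ℝ} (h : IsDual U U) {c : Fin n}
    (hc : c ≠ c.rev) : ∑ a : Fin n, (-1) ^ (a : ℕ) * (U a c * U a.rev c) = 0 := by
  have h1 := congrFun (congrFun h.transpose c) c
  rw [transpose_transpose, Matrix.mul_assoc, mul_apply, OmegaReal_apply, if_neg hc] at h1
  rw [← h1]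
  refine Finset.sum_congr rfl fun a _ => ?_
  rw [transpose_apply, OmegaReal_mul_apply]
  ring

/-- Induction over the unipotent matrices with nonnegative initial minors in the group of the form
`Omega`, by splitting off one-parameter subgroups of simple roots. -/
theorem selfDual_induction {n : ℕ} {C : Matrix (Fin n) (Fin n) ℝ → Prop} (one : C 1)
    (double : ∀ (i j : ℕ) (t : ℝ) (U : Matrix (Fin n) (Fin n) ℝ), i + j + 2 = n → i + 1 < j →
      0 < t → C U → C (elemU n i t * elemU n j t * U))
    (single : ∀ (i : ℕ) (t : ℝ) (U : Matrix (Fin n) (Fin n) ℝ), i + i + 2 = n →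
      0 < t → C U → C (elemU n i t * U))
    (middle : ∀ (i : ℕ) (t : ℝ) (U : Matrix (Fin n) (Fin n) ℝ), i + (i + 1) + 2 = n →
      0 < t → C U → C (elemMid n i t * U)) :
    ∀ U : Matrix (Fin n) (Fin n) ℝ, IsUpperUnipotent U → InitNonneg U → IsDual U U → C U := by
  intro U hU hQ hD
  refine upperUnipotent_induction
    (P := fun U => IsUpperUnipotent U ∧ InitNonneg U ∧ IsDual U U) (C := C)
    (fun U h => h.1) one ?_ U ⟨hU, hQ, hD⟩
  clear U hU hQ hD
  rintro U i c ⟨hU, hQ, hD⟩ hic htriv hz h0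
  have hic' : (i : ℕ) < c := hic
  obtain ⟨i', hi⟩ : ∃ i' : Fin n, (i' : ℕ) = i + 1 := ⟨⟨i + 1, by omega⟩, rfl⟩
  have hci : (c.rev : ℕ) ≤ i := by
    by_contra hlt
    exact h0 (hD.apply_eq_zero hU htriv (i := i) (by rw [Fin.lt_def]; omega) hic.ne')
  rw [Fin.val_rev] at hci
  have hpos0 : 0 < U i c := (hU.apply_nonneg hQ i c).lt_of_ne' h0
  have hpos := hU.apply_succ_pos hQ hi hic hz h0
  have ht : U i c = U i c / U i' c * U i' c := (div_mul_cancel₀ _ hpos.ne').symm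
  have ht0 : 0 < U i c / U i' c := div_pos hpos0 hpos
  obtain ⟨j, hj⟩ : ∃ j, (i : ℕ) + j + 2 = n := ⟨n - 2 - i, by omega⟩
  set t := U i c / U i' c
  have hQ1 : InitNonneg (elemU n i (-t) * U) := hQ.elemU_mul hi hic htriv hz hpos ht
  have hU1 : IsUpperUnipotent (elemU n i (-t) * U) := hU.elemU_mul _ _
  have hz1 : ∀ a, a ≤ i → (elemU n i (-t) * U) a c = 0 := by
    intro a ha
    rcases ha.eq_or_lt with rfl | ha
    · rw [elemU_mul_apply _ _ hi, ht]
      ring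
    · rw [elemU_mul_apply_of_ne _ _ (fun h => ha.ne (Fin.ext h)), hz a ha]
  by_cases hij : j = i
  · subst hij
    refine ⟨elemU n i (-t) * U, ⟨hU1, hQ1, (isDual_elemU hj _).mul hD⟩,
      elemU_mul_trivial_column hic' _ htriv, hz1, fun hC => ?_⟩
    have := single i t _ hj ht0 hC
    rwa [← mul_assoc, elemU_mul_neg, one_mul] at this
  by_cases hfar : (i : ℕ) + 1 < j ∨ j + 1 < i
  -- As `U` is self-dual, the dual of `elemU n i (-t) * U` is `elemU n j (-t) * U`, so the invariant
  -- transfers. The operation at `j` leaves column `c` unchanged through row `i'`, so the same `t`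
  -- still clears row `i`.
  · have hQ2 : InitNonneg (elemU n j (-t) * U) :=
      hQ1.of_isDual hU1 ((isDual_elemU (by omega) _).mul hD)
    have htriv2 := elemU_mul_trivial_column (i := j) (by omega) (-t) htriv
    have hcol : ∀ a : Fin n, (a : ℕ) ≤ i' → (elemU n j (-t) * U) a c = U a c := by
      intro a ha
      by_cases haj : (a : ℕ) = j
      · subst haj
        rw [elemU_mul_apply _ _ (a' := ⟨a + 1, by omega⟩) rfl,
          hz ⟨a + 1, by omega⟩ (by rw [Fin.lt_def]; simp only; omega), mul_zero, add_zero]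
      · rw [elemU_mul_apply_of_ne _ _ haj]
    have hz2 : ∀ a, a < i → (elemU n j (-t) * U) a c = 0 := by
      intro a ha
      have ha' : (a : ℕ) < i := ha
      rw [hcol a (by omega), hz a ha]
    have hQ3 := hQ2.elemU_mul hi hic htriv2 hz2 (by rwa [hcol i' le_rfl])
      (by rw [hcol i (by omega), hcol i' le_rfl]; exact ht)
    have hcomm : elemU n i (-t) * elemU n j (-t) = elemU n j (-t) * elemU n i (-t) :=
      elemU_comm (by omega) (by omega) _ _
    refine ⟨elemU n i (-t) * (elemU n j (-t) * U), ⟨(hU.elemU_mul _ _).elemU_mul _ _, hQ3, ?_⟩,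
      elemU_mul_trivial_column hic' _ htriv2, ?_, fun hC => ?_⟩
    · have h1 := (isDual_elemU hj (-t)).mul
        ((isDual_elemU (n := n) (i := j) (j := i) (by omega) (-t)).mul hD)
      have h2 : elemU n j (-t) * (elemU n i (-t) * U) = elemU n i (-t) * (elemU n j (-t) * U) := by
        rw [← mul_assoc, ← mul_assoc, hcomm]
      rwa [h2] at h1
    · intro a ha
      rcases ha.eq_or_lt with rfl | ha
      · rw [elemU_mul_apply _ _ hi, hcol a (by omega), hcol i' le_rfl, ht]
        ring
      · rw [elemU_mul_apply_of_ne _ _ (fun h => ha.ne (Fin.ext h)), hz2 a ha]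
    · have hcancel : elemU n j t * elemU n i t * (elemU n i (-t) * (elemU n j (-t) * U)) = U := by
        calc elemU n j t * elemU n i t * (elemU n i (-t) * (elemU n j (-t) * U))
            = elemU n j t * (elemU n i t * elemU n i (-t)) * elemU n j (-t) * U := by
              simp only [mul_assoc]
          _ = U := by rw [elemU_mul_neg, mul_one, elemU_mul_neg, one_mul]
      rw [← hcancel]
      rcases hfar with hfar | hfar
      · rw [elemU_comm (i := j) (j := i) (by omega) (by omega)]
        exact double i j t _ hj hfar ht0 hC
      · exact double j i t _ (by omega) hfar ht0 hC
  have hrev : ∀ a : Fin n, (a.rev : ℕ) = n - (a + 1) := fun a => Fin.val_rev a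
  have hcc : c ≠ c.rev := by
    intro h
    have := congrArg Fin.val h
    rw [Fin.val_rev] at this
    omega
  have hiso := hD.isotropic hcc
  -- Here `i` is the middle row of an odd-sized matrix and would be the first nonzero entry of
  -- column `c`. Isotropy reduces to `U i c ^ 2 = 0`.
  by_cases hj' : j + 1 = i
  · exfalso
    rw [Finset.sum_eq_single i] at hiso
    · have : i.rev = i := by
        ext
        rw [hrev]
        omega
      rw [this] at hiso
      have h2 : (-1 : ℝ) ^ (i : ℕ) ≠ 0 := pow_ne_zero _ (by norm_num)
      simp [h2, h0] at hiso
    · intro a _ ha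
      have ha' : (a : ℕ) ≠ i := fun h => ha (Fin.ext h)
      by_cases hai : (a : ℕ) < i
      · rw [hz a hai, zero_mul, mul_zero]
      · rw [hz a.rev (by rw [Fin.lt_def, hrev]; omega), mul_zero, mul_zero]
    · simp
  obtain rfl : j = i + 1 := by omega
  obtain ⟨k, hi'⟩ : ∃ k : Fin n, (k : ℕ) = i' + 1 := ⟨⟨i' + 1, by omega⟩, rfl⟩
  have hic2 : i' < c := by
    rw [Fin.lt_def]
    omega
  have hi2 : ∀ s, (elemU n i s * U) i' c = U i' c := fun s =>
    elemU_mul_apply_of_ne _ _ (by omega) _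
  have hi3 : ∀ s, (elemU n i s * U) k c = U k c := fun s =>
    elemU_mul_apply_of_ne _ _ (by omega) _
  have hz1' : ∀ a, a < i' → (elemU n i (-t) * U) a c = 0 := by
    intro a ha
    rw [Fin.lt_def] at ha
    exact hz1 a (by rw [Fin.le_def]; omega)
  have hpos2 : 0 < U k c := by
    have := hU1.apply_succ_pos hQ1 hi' hic2 hz1' (by rw [hi2]; exact hpos.ne')
    rwa [hi3] at this
  -- isotropy of the column `c` determines its first nonzero entry
  have hquad : 2 * (U i c * U k c) = U i' c * U i' c := by
    have hr1 : i.rev = k := by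
      ext
      rw [hrev]
      omega
    have hr2 : i'.rev = i' := by
      ext
      rw [hrev]
      omega
    have hr3 : k.rev = i := by
      ext
      rw [hrev]
      omega
    rw [← Finset.sum_subset (Finset.subset_univ {i, i', k})] at hiso
    · rw [Finset.sum_insert, Finset.sum_insert, Finset.sum_singleton, hr1, hr2, hr3, hi', hi] at hiso
      · have h2 : (-1 : ℝ) ^ (i : ℕ) ≠ 0 := pow_ne_zero _ (by norm_num)
        apply mul_left_cancel₀ h2
        simp only [pow_succ] at hiso
        linear_combination hiso
      · simp only [Finset.mem_singleton, Fin.ext_iff]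
        omega
      · simp only [Finset.mem_singleton, Finset.mem_insert, Fin.ext_iff]
        omega
    · intro a _ ha
      simp only [Finset.mem_singleton, Finset.mem_insert, Fin.ext_iff, not_or] at ha
      by_cases hai : (a : ℕ) < i
      · rw [hz a hai, zero_mul, mul_zero]
      · rw [hz a.rev (by rw [Fin.lt_def, hrev]; omega), mul_zero, mul_zero]
  -- Clearing row `i` takes the parameter `t`, and by isotropy clearing row `i'` then takes exactly
  -- `2 * t`. This ratio is what makes the three operations below combine into one `elemMid`.
  have hs : U i' c = 2 * t * U k c := by
    have h1 : 2 * t * U i' c * U k c = U i' c * U i' c := by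
      rw [← hquad]
      linear_combination (-2) * U k c * ht
    apply mul_left_cancel₀ hpos.ne'
    linear_combination -h1
  have hQ2 : InitNonneg (elemU n (i + 1) (-(2 * t)) * (elemU n i (-t) * U)) := by
    have := hQ1.elemU_mul hi' hic2 (elemU_mul_trivial_column hic' _ htriv) hz1'
      (by rwa [hi3]) (t := 2 * t) (by rw [hi2, hi3, hs])
    rwa [hi] at this
  -- Dualizing exchanges `i` and `i + 1` in the two operations. In the new matrix `V`, column `c`
  -- has entry `t * U k c` in row `i'` and zeros above, so one more operation at `i'` with parameter
  -- `t` completes the word.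
  have hQ3 : InitNonneg (elemU n i (-(2 * t)) * (elemU n (i + 1) (-t) * U)) :=
    hQ2.of_isDual (hU1.elemU_mul _ _) ((isDual_elemU (by omega) _).mul
      ((isDual_elemU (by omega) _).mul hD))
  set V := elemU n i (-(2 * t)) * (elemU n (i + 1) (-t) * U) with hV
  have hV1 : V i' c = t * U k c := by
    rw [hV, elemU_mul_apply_of_ne _ _ (by omega), ← hi, elemU_mul_apply _ _ hi', hs]
    ring
  have hV2 : V k c = U k c := by
    rw [hV, elemU_mul_apply_of_ne _ _ (by omega), elemU_mul_apply_of_ne _ _ (by omega)]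
  have hVz : ∀ a, a < i' → V a c = 0 := by
    intro a ha
    have ha' : (a : ℕ) < i' := ha
    by_cases hai : (a : ℕ) = i
    · obtain rfl : a = i := Fin.ext hai
      rw [hV, elemU_mul_apply _ _ hi, elemU_mul_apply_of_ne _ _ (by omega), ← hi,
        elemU_mul_apply _ _ hi', ht, hs]
      ring
    · rw [hV, elemU_mul_apply_of_ne _ _ hai, elemU_mul_apply_of_ne _ _ (by omega),
        hz a (by rw [Fin.lt_def]; omega)]
  have hVtriv : ∀ d, c < d → ∀ a, a ≠ d → V a d = 0 :=
    elemU_mul_trivial_column hic' _ (elemU_mul_trivial_column (by omega) _ htriv)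
  have hQ4 := hQ3.elemU_mul hi' hic2 hVtriv hVz (by rwa [hV2]) (t := t) (by rw [hV1, hV2])
  have hW : elemU n i' (-t) * V = elemMid n i (-(2 * t)) * U := by
    rw [elemMid_eq_mul', hV, hi, show -(2 * t) / 2 = -t by ring]
    simp only [mul_assoc]
  refine ⟨elemMid n i (-(2 * t)) * U, ⟨?_, hW ▸ hQ4, ?_⟩, ?_, ?_, fun hC => ?_⟩
  · rw [← hW]
    exact ((hU.elemU_mul _ _).elemU_mul _ _).elemU_mul _ _
  · refine IsDual.mul ?_ hD
    nth_rewrite 1 [elemMid_eq_mul]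
    rw [elemMid_eq_mul']
    exact (isDual_elemU (by omega) _).mul
      ((isDual_elemU (by omega) _).mul (isDual_elemU (by omega) _))
  · rw [← hW]
    exact elemU_mul_trivial_column hic2 _ hVtriv
  · intro a ha
    have ha' : (a : ℕ) ≤ i := ha
    rw [← hW, elemU_mul_apply_of_ne _ _ (by omega), hVz a (by rw [Fin.lt_def]; omega)]
  · have := middle i (2 * t) _ hj (by linarith) hC
    rwa [← mul_assoc, elemMid_mul_neg, one_mul] at this

/-! ### Gauss decomposition -/

theorem RealTNN.transpose {n : ℕ} {A : Matrix (Fin n) (Fin n) ℝ} (h : RealTNN A) :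
    RealTNN Aᵀ := by
  intro m r f
  have := h m f r
  rwa [← det_transpose, transpose_submatrix] at this

/-- Clearing the first column by row operations leaves the Schur complement of `A 0 0`. Its minors
are therefore minors of `A` divided by `A 0 0`, and total nonnegativity descends to it. -/
theorem det_submatrix_cons_zero {n m : ℕ} (A : Matrix (Fin (n + 1)) (Fin (n + 1)) ℝ)
    (h0 : A 0 0 ≠ 0) (r c : Fin m → Fin n) :
    (A.submatrix (Fin.cons 0 (Fin.succ ∘ r) : Fin (m + 1) → Fin (n + 1))
      (Fin.cons 0 (Fin.succ ∘ c) : Fin (m + 1) → Fin (n + 1))).det =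
    A 0 0 * ((of fun i j : Fin n =>
      A i.succ j.succ - A i.succ 0 / A 0 0 * A 0 j.succ).submatrix r c).det := by
  let r' : Fin (m + 1) → Fin (n + 1) := Fin.cons 0 (Fin.succ ∘ r)
  let c' : Fin (m + 1) → Fin (n + 1) := Fin.cons 0 (Fin.succ ∘ c)
  let k : Fin (m + 1) → ℝ := Fin.cons 0 fun i => A (r i).succ 0 / A 0 0
  let B : Matrix (Fin (m + 1)) (Fin (m + 1)) ℝ := of fun a b => A (r' a) (c' b) - k a * A 0 (c' b)
  have hB0 : ∀ b, B 0 b = A 0 (c' b) := by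
    intro b
    simp [B, r', k]
  rw [det_eq_of_forall_row_eq_smul_add_const (B := B) k 0 (by simp [k])]
  · rw [det_succ_column_zero, Fin.sum_univ_succ]
    rw [Finset.sum_eq_zero, add_zero]
    · have : B.submatrix Fin.succ Fin.succ = (of fun i j : Fin n =>
          A i.succ j.succ - A i.succ 0 / A 0 0 * A 0 j.succ).submatrix r c := by
        ext a b
        simp [B, r', c', k]
      simp only [Fin.succAbove_zero, this, hB0]
      simp [c']
    · intro a _
      have : B a.succ 0 = 0 := by
        simp [B, r', c', k, h0]
      rw [this, mul_zero, zero_mul]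
  · intro a b
    rw [hB0]
    simp [B, r', c']

/-- Adjoining `0` to the image of an order embedding shifted by one. -/
def consEmb {n m : ℕ} (f : Fin m ↪o Fin n) : Fin (m + 1) ↪o Fin (n + 1) :=
  OrderEmbedding.ofStrictMono (Fin.cons 0 (Fin.succ ∘ f) : Fin (m + 1) → Fin (n + 1)) (by
    intro a b hab
    induction b using Fin.cases with
    | zero => exact absurd hab (Fin.not_lt_zero _)
    | succ b =>
      induction a using Fin.cases with
      | zero => simp
      | succ a => simpa using hab)

/-- The order embedding of a one-element set. -/
def singleEmb {n : ℕ} (i : Fin n) : Fin 1 ↪o Fin n :=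
  OrderEmbedding.ofStrictMono (fun _ => i) (Subsingleton.strictMono _)

theorem RealTNN.apply_nonneg {n : ℕ} {A : Matrix (Fin n) (Fin n) ℝ} (h : RealTNN A)
    (i j : Fin n) : 0 ≤ A i j := by
  have := h 1 (singleEmb i) (singleEmb j)
  rw [det_fin_one] at this
  exact this

/-- If `A 0 0 = 0`, the `2 × 2` minors through the corner force every product `A 0 j * A i 0` to
vanish, so the first row or the first column is zero. -/
theorem RealTNN.apply_zero_pos {n : ℕ} {A : Matrix (Fin (n + 1)) (Fin (n + 1)) ℝ}
    (h : RealTNN A) (hdet : A.det ≠ 0) : 0 < A 0 0 := by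
  refine (h.apply_nonneg 0 0).lt_of_ne' fun h0 => hdet ?_
  have hprod : ∀ i j : Fin n, A 0 j.succ * A i.succ 0 = 0 := by
    intro i j
    have := h 2 (consEmb (singleEmb i)) (consEmb (singleEmb j))
    rw [det_fin_two] at this
    have h2 : 0 ≤ A 0 0 * A i.succ j.succ - A 0 j.succ * A i.succ 0 := this
    rw [h0, zero_mul, zero_sub] at h2
    have := mul_nonneg (h.apply_nonneg 0 j.succ) (h.apply_nonneg i.succ 0)
    linarith
  by_cases hrow : ∀ j : Fin n, A 0 j.succ = 0
  · exact det_eq_zero_of_row_eq_zero 0 (Fin.cases h0 hrow)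
  · push Not at hrow
    obtain ⟨j, hj⟩ := hrow
    exact det_eq_zero_of_column_eq_zero 0
      (Fin.cases h0 fun i => (mul_eq_zero.1 (hprod i j)).resolve_left hj)

/-- Gauss decomposition of invertible totally nonnegative matrices. -/
theorem RealTNN.exists_ldu {n : ℕ} {A : Matrix (Fin n) (Fin n) ℝ} (h : RealTNN A)
    (hdet : A.det ≠ 0) :
    ∃ (L U : Matrix (Fin n) (Fin n) ℝ) (d : Fin n → ℝ), IsUpperUnipotent Lᵀ ∧
      IsUpperUnipotent U ∧ (∀ i, 0 < d i) ∧ A = L * diagonal d * U := by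
  induction n with
  | zero =>
    exact ⟨1, 1, fun _ => 1, ⟨fun a => a.elim0, fun a => a.elim0⟩,
      ⟨fun a => a.elim0, fun a => a.elim0⟩, fun a => a.elim0, Subsingleton.elim _ _⟩
  | succ n ih =>
    have h00 := h.apply_zero_pos hdet
    have hschur := fun {m : ℕ} (r c : Fin m → Fin n) => det_submatrix_cons_zero A h00.ne' r c
    set B : Matrix (Fin n) (Fin n) ℝ :=
      of fun i j : Fin n => A i.succ j.succ - A i.succ 0 / A 0 0 * A 0 j.succ with hB
    have hBT : RealTNN B := by
      intro m r f
      have h1 := h (m + 1) (consEmb r) (consEmb f)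
      have h2 := hschur r f
      change 0 ≤ (A.submatrix (Fin.cons 0 (Fin.succ ∘ r) : Fin (m + 1) → Fin (n + 1))
        (Fin.cons 0 (Fin.succ ∘ f) : Fin (m + 1) → Fin (n + 1))).det at h1
      rw [h2] at h1
      exact nonneg_of_mul_nonneg_right h1 h00
    have hBdet : B.det ≠ 0 := by
      intro hB0
      apply hdet
      have h2 := hschur id id
      have e : (Fin.cons 0 (Fin.succ ∘ id) : Fin (n + 1) → Fin (n + 1)) = id := by
        ext a
        induction a using Fin.cases <;> simp
      rw [e, submatrix_id_id, submatrix_id_id, hB0, mul_zero] at h2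
      exact h2
    obtain ⟨L, U, d, hL, hU, hd, hLU⟩ := ih hBT hBdet
    refine ⟨of (Fin.cons (Fin.cons 1 0) fun i => Fin.cons (A i.succ 0 / A 0 0) (L i)),
      of (Fin.cons (Fin.cons 1 fun j => A 0 j.succ / A 0 0) fun i => Fin.cons 0 (U i)),
      Fin.cons (A 0 0) d, ⟨?_, ?_⟩, ⟨?_, ?_⟩, ?_, ?_⟩
    · intro a b hab
      induction a using Fin.cases with
      | zero => exact absurd hab (Fin.not_lt_zero _)
      | succ a =>
        induction b using Fin.cases with
        | zero => simp
        | succ b => simpa using hL.1 a b (by simpa using hab)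
    · intro a
      induction a using Fin.cases with
      | zero => simp
      | succ a => simpa using hL.2 a
    · intro a b hab
      induction a using Fin.cases with
      | zero => exact absurd hab (Fin.not_lt_zero _)
      | succ a =>
        induction b using Fin.cases with
        | zero => simp
        | succ b => simpa using hU.1 a b (by simpa using hab)
    · intro a
      induction a using Fin.cases with
      | zero => simp
      | succ a => simpa using hU.2 a
    · intro a
      induction a using Fin.cases with
      | zero => simpa using h00
      | succ a => simpa using hd a
    · ext a b
      rw [mul_apply, Fin.sum_univ_succ]
      simp only [mul_diagonal, of_apply, Fin.cons_zero, Fin.cons_succ]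
      induction a using Fin.cases with
      | zero =>
        induction b using Fin.cases with
        | zero => simp
        | succ b => simp [mul_div_cancel₀ _ h00.ne']
      | succ a =>
        induction b using Fin.cases with
        | zero => simp [h00.ne']
        | succ b =>
          have h3 := congrFun (congrFun hLU a) b
          rw [mul_apply] at h3
          simp only [mul_diagonal, hB, of_apply] at h3
          simp only [Fin.cons_succ, Fin.cons_zero]
          rw [← h3]
          field_simp
          ring

theorem InitNonneg.of_ldu {n : ℕ} {L U : Matrix (Fin n) (Fin n) ℝ} {d : Fin n → ℝ}
    (hL : IsUpperUnipotent Lᵀ) (hd : ∀ i, 0 < d i) (h : RealTNN (L * diagonal d * U)) :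
    InitNonneg U := by
  intro m hm f
  have h1 := h m (Fin.castLEOrderEmb hm) f
  -- Lower triangularity of `L * diagonal d` makes the first `m` rows of the product depend only on
  -- the first `m` rows of `U`, through a triangular block of positive determinant.
  have key : (L * diagonal d * U).submatrix (Fin.castLEOrderEmb hm) f =
      (L * diagonal d).submatrix (Fin.castLE hm) (Fin.castLE hm) *
        U.submatrix (Fin.castLE hm) f := by
    ext a b
    rw [submatrix_apply, mul_apply, mul_apply]
    refine (Fintype.sum_of_injective (Fin.castLE hm) (Fin.castLE_injective hm) _ _ ?_ ?_).symm
    · intro x hx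
      have : Fin.castLE hm a < x := by
        by_contra hlt
        rw [Fin.lt_def, Fin.val_castLE] at hlt
        exact hx ⟨⟨x, by omega⟩, Fin.ext rfl⟩
      rw [mul_diagonal]
      have h2 := hL.1 x (Fin.castLE hm a) this
      rw [transpose_apply] at h2
      change L (Fin.castLE hm a) x * d x * U x (f b) = 0
      rw [h2, zero_mul, zero_mul]
    · intro x
      rfl
  have hdet : 0 < ((L * diagonal d).submatrix (Fin.castLE hm) (Fin.castLE hm)).det := by
    rw [← det_transpose, det_of_isUpperTriangular]
    · refine Finset.prod_pos fun i _ => ?_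
      have := hL.2 (Fin.castLE hm i)
      rw [transpose_apply] at this
      rw [transpose_apply, submatrix_apply, mul_diagonal, this, one_mul]
      exact hd _
    · intro a b hab
      have := hL.1 (Fin.castLE hm a) (Fin.castLE hm b) hab
      rw [transpose_apply] at this
      rw [transpose_apply, submatrix_apply, mul_diagonal, this, zero_mul]
  rw [key, det_mul] at h1
  exact nonneg_of_mul_nonneg_right h1 hdet

theorem IsUpperUnipotent.mul {n : ℕ} {U V : Matrix (Fin n) (Fin n) ℝ} (hU : IsUpperUnipotent U)
    (hV : IsUpperUnipotent V) : IsUpperUnipotent (U * V) := by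
  refine ⟨fun a b hab => ?_, fun a => ?_⟩
  · rw [mul_apply]
    refine Finset.sum_eq_zero fun x _ => ?_
    rcases lt_or_ge x a with hx | hx
    · rw [hU.1 a x hx, zero_mul]
    · rw [hV.1 x b (hab.trans_le hx), mul_zero]
  · rw [mul_apply, Finset.sum_eq_single a]
    · rw [hU.2, hV.2, one_mul]
    · intro x _ hx
      rcases lt_or_gt_of_ne hx with hx | hx
      · rw [hU.1 a x hx, zero_mul]
      · rw [hV.1 x a hx, mul_zero]
    · simp

theorem IsUpperUnipotent.conj_transpose {n : ℕ} {U : Matrix (Fin n) (Fin n) ℝ}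
    (hU : IsUpperUnipotent U) : IsUpperUnipotent (OmegaReal n * Uᵀ * (OmegaReal n)ᵀ) := by
  have key : ∀ a b, (OmegaReal n * Uᵀ * (OmegaReal n)ᵀ) a b =
      (-1) ^ (a : ℕ) * (-1) ^ (b : ℕ) * U b.rev a.rev := by
    intro a b
    rw [← transpose_transpose (OmegaReal n * Uᵀ), ← transpose_mul, transpose_apply,
      OmegaReal_mul_apply, transpose_apply, OmegaReal_mul_apply, transpose_apply]
    ring
  refine ⟨fun a b hab => ?_, fun a => ?_⟩
  · rw [key, hU.1 _ _ (Fin.rev_lt_rev.2 hab), mul_zero]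
  · rw [key, hU.2, mul_one, ← pow_add, ← two_mul, pow_mul]
    simp

/-- This is uniqueness of the Gauss decomposition, obtained row by row: once the earlier rows of `K`
are those of `1`, row `a` of `N` is read off from `N * K = 1`, and then row `a` of `K`. -/
theorem eq_one_of_lower_mul_upper {n : ℕ} {N K : Matrix (Fin n) (Fin n) ℝ}
    (hN : IsUpperUnipotent Nᵀ) (hK : ∀ a b, b < a → K a b = 0) (h : N * K = 1) :
    N = 1 ∧ K = 1 := by
  have hup : ∀ a x, a < x → N a x = 0 := fun a x hax => hN.1 x a hax
  have hdiag : ∀ a, N a a = 1 := hN.2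
  have hrow : ∀ (m : ℕ) (a : Fin n), (a : ℕ) = m →
      (∀ b, N a b = (1 : Matrix (Fin n) (Fin n) ℝ) a b) ∧
      ∀ b, K a b = (1 : Matrix (Fin n) (Fin n) ℝ) a b := by
    intro m
    induction m using Nat.strong_induction_on with
    | _ m ih =>
      intro a ha
      have hNa : ∀ b, N a b = (1 : Matrix (Fin n) (Fin n) ℝ) a b := by
        intro b
        rcases lt_trichotomy b a with hba | rfl | hab
        · have h1 := congrFun (congrFun h a) b
          rw [mul_apply, Finset.sum_eq_single b] at h1
          · rw [(ih b (ha ▸ hba) b rfl).2, one_apply_eq, mul_one] at h1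
            exact h1
          · intro x _ hx
            rcases lt_trichotomy x a with hxa | rfl | hax
            · rw [(ih x (ha ▸ hxa) x rfl).2, one_apply_ne hx, mul_zero]
            · rw [hK _ _ hba, mul_zero]
            · rw [hup a x hax, zero_mul]
          · simp
        · rw [hdiag, one_apply_eq]
        · rw [hup a b hab, one_apply_ne hab.ne]
      refine ⟨hNa, fun b => ?_⟩
      rw [← h, mul_apply, Finset.sum_eq_single a]
      · rw [hdiag, one_mul]
      · intro x _ hx
        rw [hNa, one_apply_ne hx.symm, zero_mul]
      · simp
  exact ⟨ext fun a b => (hrow a a rfl).1 b, ext fun a b => (hrow a a rfl).2 b⟩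

theorem isDual_of_mul_conj_transpose {n : ℕ} {U : Matrix (Fin n) (Fin n) ℝ}
    (h : U * (OmegaReal n * Uᵀ * (OmegaReal n)ᵀ) = 1) : IsDual U U := by
  unfold IsDual
  calc U * OmegaReal n * Uᵀ
      = U * OmegaReal n * Uᵀ * ((OmegaReal n)ᵀ * OmegaReal n) := by
        rw [OmegaReal_transpose_mul, Matrix.mul_one]
    _ = U * (OmegaReal n * Uᵀ * (OmegaReal n)ᵀ) * OmegaReal n := by simp only [Matrix.mul_assoc]
    _ = OmegaReal n := by rw [h, Matrix.one_mul]

theorem OmegaReal_conj_diagonal {n : ℕ} (d : Fin n → ℝ) :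
    OmegaReal n * diagonal d * (OmegaReal n)ᵀ = diagonal fun i => d i.rev := by
  have : OmegaReal n * diagonal d = diagonal (fun i => d i.rev) * OmegaReal n := by
    ext a b
    rw [mul_diagonal, diagonal_mul, OmegaReal_apply]
    by_cases h : b = a.rev
    · rw [if_pos h, h, mul_comm]
    · rw [if_neg h, zero_mul, mul_zero]
  rw [this, Matrix.mul_assoc, OmegaReal_mul_transpose, Matrix.mul_one]

/-- The factors of the Gauss decomposition of a matrix in the group of the form `Omega` belong to
this group. -/
theorem IsDual.ldu {n : ℕ} {L U : Matrix (Fin n) (Fin n) ℝ} {d : Fin n → ℝ}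
    (hL : IsUpperUnipotent Lᵀ) (hU : IsUpperUnipotent U) (hd : ∀ i, 0 < d i)
    (h : IsDual (L * diagonal d * U) (L * diagonal d * U)) :
    IsDual Lᵀ Lᵀ ∧ IsDual U U ∧ ∀ i, d i * d i.rev = 1 := by
  set X := U * (OmegaReal n * Uᵀ * (OmegaReal n)ᵀ) with hX
  set Y := Lᵀ * (OmegaReal n * Lᵀᵀ * (OmegaReal n)ᵀ) with hY
  have hXu : IsUpperUnipotent X := hU.mul hU.conj_transpose
  have hYu : IsUpperUnipotent Y := hL.mul hL.conj_transpose
  set K := diagonal d * X * diagonal fun i => d i.rev with hK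
  have hKX : ∀ a b, K a b = d a * d b.rev * X a b := by
    intro a b
    rw [hK, mul_diagonal, diagonal_mul]
    ring
  have h1 : L * (K * (OmegaReal n * Lᵀ * (OmegaReal n)ᵀ)) = 1 := by
    have h2 : L * diagonal d * U * OmegaReal n * (L * diagonal d * U)ᵀ * (OmegaReal n)ᵀ = 1 := by
      rw [h, OmegaReal_mul_transpose]
    rw [← h2, hK, hX, ← OmegaReal_conj_diagonal, transpose_mul, transpose_mul, diagonal_transpose]
    have e : ∀ M : Matrix (Fin n) (Fin n) ℝ, (OmegaReal n)ᵀ * (OmegaReal n * M) = M := by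
      intro M
      rw [← Matrix.mul_assoc, OmegaReal_transpose_mul, Matrix.one_mul]
    simp only [Matrix.mul_assoc, e]
  -- The last, lower unipotent factor of `h1` is moved cyclically to the front, where it merges with
  -- `L` into `Yᵀ`; the identity is now lower unipotent times upper triangular.
  have h2 : Yᵀ * K = 1 := by
    have h3 := mul_eq_one_comm.1 h1
    rw [Matrix.mul_assoc] at h3
    have h4 := mul_eq_one_comm.1 h3
    rw [← h4, hY]
    simp only [transpose_mul, transpose_transpose, Matrix.mul_assoc]
  have h5 := eq_one_of_lower_mul_upper (N := Yᵀ) (by rwa [transpose_transpose])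
    (fun a b hab => by rw [hKX, hXu.1 a b hab, mul_zero]) h2
  have hdd : ∀ i, d i * d i.rev = 1 := by
    intro i
    have := congrFun (congrFun h5.2 i) i
    rwa [hKX, hXu.2, mul_one, one_apply_eq] at this
  refine ⟨isDual_of_mul_conj_transpose ?_, isDual_of_mul_conj_transpose ?_, hdd⟩
  · rw [← hY, ← transpose_transpose Y, h5.1, transpose_one]
  · rw [← hX]
    ext a b
    by_cases hab : a = b
    · rw [hab, hXu.2, one_apply_eq]
    · have := congrFun (congrFun h5.2 a) b
      rw [hKX, one_apply_ne hab] at this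
      rw [one_apply_ne hab]
      exact (mul_eq_zero.1 this).resolve_left (mul_pos (hd _) (hd _)).ne'

/-! ### Complex matrices and exponentials of the generators -/

/-- The embedding of real matrices into complex matrices. -/
noncomputable abbrev toComplex (n : ℕ) : Matrix (Fin n) (Fin n) ℝ →+* Matrix (Fin n) (Fin n) ℂ :=
  Complex.ofRealHom.mapMatrix

theorem toComplex_injective (n : ℕ) : Function.Injective (toComplex n) :=
  map_injective Complex.ofReal_injective

theorem toComplex_apply {n : ℕ} (M : Matrix (Fin n) (Fin n) ℝ) (a b : Fin n) :
    toComplex n M a b = (M a b : ℂ) := rfl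

theorem toComplex_transpose {n : ℕ} (M : Matrix (Fin n) (Fin n) ℝ) :
    toComplex n Mᵀ = (toComplex n M)ᵀ := rfl

theorem toComplex_smul {n : ℕ} (t : ℝ) (M : Matrix (Fin n) (Fin n) ℝ) :
    toComplex n (t • M) = (t : ℂ) • toComplex n M := by
  ext a b
  simp [toComplex_apply]

theorem toComplex_OmegaReal (n : ℕ) : toComplex n (OmegaReal n) = Omega n := by
  ext a b
  rw [toComplex_apply, OmegaReal, Omega, of_apply, of_apply]
  split_ifs <;> simp

theorem det_submatrix_toComplex {n m : ℕ} (M : Matrix (Fin n) (Fin n) ℝ) (r c : Fin m → Fin n) :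
    ((toComplex n M).submatrix r c).det = ((M.submatrix r c).det : ℂ) :=
  (RingHom.map_det Complex.ofRealHom (M.submatrix r c)).symm

theorem isTotallyNonneg_toComplex {n : ℕ} {M : Matrix (Fin n) (Fin n) ℝ} :
    IsTotallyNonneg (toComplex n M) ↔ RealTNN M := by
  constructor
  · intro h m r c
    obtain ⟨x, hx, hdet⟩ := h m r c
    rw [det_submatrix_toComplex, Complex.ofReal_inj] at hdet
    rwa [hdet]
  · intro h m r c
    exact ⟨_, h m r c, det_submatrix_toComplex M r c⟩

theorem IsTotallyNonneg.exists_real {n : ℕ} {A : Matrix (Fin n) (Fin n) ℂ}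
    (h : IsTotallyNonneg A) : ∃ M, A = toComplex n M := by
  have : ∀ i j, ∃ x : ℝ, A i j = x := by
    intro i j
    obtain ⟨x, -, hx⟩ := h 1 (singleEmb i) (singleEmb j)
    rw [det_fin_one] at hx
    exact ⟨x, hx⟩
  choose M hM using this
  exact ⟨of M, ext fun i j => hM i j⟩

theorem mem_GOmega_iff {n : ℕ} {A : GL (Fin n) ℂ} {M : Matrix (Fin n) (Fin n) ℝ}
    (h : (A : Matrix (Fin n) (Fin n) ℂ) = toComplex n M) : A ∈ GOmega n ↔ IsDual M M := by
  change (A : Matrix (Fin n) (Fin n) ℂ) * Omega n * (A : Matrix (Fin n) (Fin n) ℂ)ᵀ = Omega n ↔ _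
  rw [h, ← toComplex_OmegaReal, ← toComplex_transpose, ← map_mul, ← map_mul,
    (toComplex_injective n).eq_iff]
  rfl

theorem unitMat_eq_superUnit (n i : ℕ) :
    unitMat n (i + 1) (i + 2) = toComplex n (superUnit n i) := by
  ext a b
  rw [toComplex_apply, unitMat, superUnit, of_apply, of_apply]
  simp only [Nat.add_right_cancel_iff, show ∀ b : ℕ, b + 1 = i + 2 ↔ b = i + 1 by omega]
  split_ifs <;> simp

theorem exp_toComplex_of_cube_eq_zero {n : ℕ} {N : Matrix (Fin n) (Fin n) ℝ}
    (h : N * N * N = 0) :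
    NormedSpace.exp (toComplex n N) = toComplex n (1 + N + (1 / 2 : ℝ) • (N * N)) := by
  have hN : toComplex n N ^ 3 = 0 := by
    rw [← map_pow, pow_succ, pow_two, h, map_zero]
  rw [NormedSpace.exp_eq_tsum ℂ]
  simp only
  rw [tsum_eq_sum (s := Finset.range 3)]
  · rw [Finset.sum_range_succ, Finset.sum_range_succ, Finset.sum_range_one, map_add, map_add,
      map_one, toComplex_smul, map_mul, pow_two]
    simp
  · intro k hk
    rw [Finset.mem_range, not_lt] at hk
    rw [pow_eq_zero_of_le hk hN, smul_zero]

theorem exp_chevE_of_lt {n i j : ℕ} (hn : i + j + 2 = n) (hij : i + 1 < j) (t : ℝ) :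
    NormedSpace.exp ((t : ℂ) • chevE n (i + 1)) = toComplex n (elemU n i t * elemU n j t) := by
  have hE : chevE n (i + 1) = toComplex n (superUnit n i + superUnit n j) := by
    rw [chevE, if_pos (by omega), map_add, ← unitMat_eq_superUnit, ← unitMat_eq_superUnit]
    congr 2 <;> omega
  have h1 : superUnit n i * superUnit n i = 0 := superUnit_mul_superUnit (by omega)
  have h2 : superUnit n i * superUnit n j = 0 := superUnit_mul_superUnit (by omega)
  have h3 : superUnit n j * superUnit n i = 0 := superUnit_mul_superUnit (by omega)
  have h4 : superUnit n j * superUnit n j = 0 := superUnit_mul_superUnit (by omega)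
  have hsq : (t • (superUnit n i + superUnit n j)) * (t • (superUnit n i + superUnit n j)) = 0 := by
    simp [add_mul, mul_add, h1, h2, h3, h4]
  rw [hE, ← toComplex_smul, exp_toComplex_of_cube_eq_zero (by rw [hsq, zero_mul]), hsq]
  congr 1
  simp only [elemU, add_mul, mul_add, one_mul, mul_one, smul_mul_assoc, mul_smul_comm, h2,
    smul_zero, add_zero, smul_add]
  abel

theorem exp_chevE_even {n i : ℕ} (hn : i + i + 2 = n) (t : ℝ) :
    NormedSpace.exp ((t : ℂ) • chevE n (i + 1)) = toComplex n (elemU n i t) := by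
  have hE : chevE n (i + 1) = toComplex n (superUnit n i) := by
    rw [chevE, if_neg (by omega), if_pos ⟨i + 1, by omega⟩, unitMat_eq_superUnit]
  have h1 : superUnit n i * superUnit n i = 0 := superUnit_mul_superUnit (by omega)
  have hsq : (t • superUnit n i) * (t • superUnit n i) = 0 := by
    simp [h1]
  rw [hE, ← toComplex_smul, exp_toComplex_of_cube_eq_zero (by rw [hsq, zero_mul]), hsq, smul_zero,
    add_zero, elemU]

theorem exp_chevE_odd {n i : ℕ} (hn : i + (i + 1) + 2 = n) (t : ℝ) :
    NormedSpace.exp ((t : ℂ) • chevE n (i + 1)) = toComplex n (elemMid n i (t * √2)) := by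
  have hE : (t : ℂ) • chevE n (i + 1) =
      toComplex n ((t * √2) • (superUnit n i + superUnit n (i + 1))) := by
    rw [chevE, if_neg (by omega), if_neg (by rw [Nat.not_even_iff_odd]; exact ⟨i + 1, by omega⟩),
      unitMat_eq_superUnit, unitMat_eq_superUnit n (i + 1), ← map_add, ← toComplex_smul,
      ← toComplex_smul, smul_smul]
  generalize t * √2 = s at hE ⊢
  have h1 : superUnit n i * superUnit n i = 0 := superUnit_mul_superUnit (by omega)
  have h3 : superUnit n (i + 1) * superUnit n i = 0 := superUnit_mul_superUnit (by omega)
  have h4 : superUnit n (i + 1) * superUnit n (i + 1) = 0 := superUnit_mul_superUnit (by omega)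
  have hsq : (s • (superUnit n i + superUnit n (i + 1))) *
      (s • (superUnit n i + superUnit n (i + 1))) =
      (s * s) • (superUnit n i * superUnit n (i + 1)) := by
    simp [add_mul, mul_add, h1, h3, h4, smul_smul]
  rw [hE, exp_toComplex_of_cube_eq_zero, hsq, elemMid, smul_smul]
  · congr 3
    ring
  · rw [hsq]
    simp [mul_add, mul_assoc, h3, h4]

theorem exists_exp_chevE {n i : ℕ} (h1 : 1 ≤ i) (h2 : i ≤ n / 2) {t : ℝ} (ht : 0 < t) :
    ∃ G : Matrix (Fin n) (Fin n) ℝ, PreservesMinors G ∧ PreservesMinors Gᵀ ∧ IsDual G G ∧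
      NormedSpace.exp ((t : ℂ) • chevE n i) = toComplex n G := by
  obtain ⟨i, rfl⟩ : ∃ j, i = j + 1 := ⟨i - 1, by omega⟩
  by_cases hlt : i + 1 < n / 2
  · obtain ⟨j, hj⟩ : ∃ j, i + j + 2 = n := ⟨n - 2 - i, by omega⟩
    refine ⟨_, ?_, ?_, ?_, exp_chevE_of_lt hj (by omega) t⟩
    · exact (preservesMinors_elemU _ _ ht.le).mul (preservesMinors_elemU _ _ ht.le)
    · rw [transpose_mul]
      exact (preservesMinors_elemU_transpose _ _ ht.le).mul
        (preservesMinors_elemU_transpose _ _ ht.le)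
    · nth_rewrite 2 [elemU_comm (by omega) (by omega)]
      exact (isDual_elemU hj t).mul (isDual_elemU (by omega) t)
  · rcases Nat.even_or_odd' n with ⟨k, hk | hk⟩
    · refine ⟨_, preservesMinors_elemU _ _ ht.le, preservesMinors_elemU_transpose _ _ ht.le, ?_,
        exp_chevE_even (by omega) t⟩
      exact isDual_elemU (by omega) t
    · have hs : 0 < t * √2 := by positivity
      refine ⟨_, ?_, ?_, ?_, exp_chevE_odd (by omega) t⟩
      · rw [elemMid_eq_mul]
        exact (preservesMinors_elemU _ _ (by positivity)).mul
          ((preservesMinors_elemU _ _ hs.le).mul (preservesMinors_elemU _ _ (by positivity)))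
      · rw [elemMid_eq_mul, transpose_mul, transpose_mul]
        exact ((preservesMinors_elemU_transpose _ _ (by positivity)).mul
          (preservesMinors_elemU_transpose _ _ hs.le)).mul
          (preservesMinors_elemU_transpose _ _ (by positivity))
      · nth_rewrite 1 [elemMid_eq_mul]
        rw [elemMid_eq_mul']
        exact (isDual_elemU (by omega) _).mul
          ((isDual_elemU (by omega) _).mul (isDual_elemU (by omega) _))

/-! ### Elements of the monoid are totally nonnegative -/

theorem torus_apply_of_ne {n : ℕ} (H : torus n) {i j : Fin n} (hij : i ≠ j) :
    ((H : GL (Fin n) ℂ) : Matrix (Fin n) (Fin n) ℂ) i j = 0 := by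
  obtain ⟨x, -, hx⟩ := H.2
  rw [hx, diagonal_apply_ne _ hij]

/-- The coordinate characters of the torus. -/
noncomputable def coordChar {n : ℕ} (i : Fin n) : torus n →* ℂˣ :=
  MonoidHom.toHomUnits
    { toFun := fun H => ((H : GL (Fin n) ℂ) : Matrix (Fin n) (Fin n) ℂ) i i
      map_one' := by simp
      map_mul' := by
        intro H K
        rw [Subgroup.coe_mul, Units.val_mul, mul_apply, Finset.sum_eq_single i]
        · intro x _ hx
          rw [torus_apply_of_ne H hx.symm, zero_mul]
        · simp }

theorem isAlgebraicCharacter_coordChar {n : ℕ} (i : Fin n) :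
    IsAlgebraicCharacter (coordChar i) :=
  ⟨MvPolynomial.X (some (i, i)), fun H => by
    rw [MvPolynomial.eval_X]
    rfl⟩

theorem exists_diagonal_of_mem_torusPos {n : ℕ} {A : GL (Fin n) ℂ} (hA : A ∈ torusPos n) :
    ∃ d : Fin n → ℝ, (∀ i, 0 < d i) ∧ (∀ i, d i * d i.rev = 1) ∧
      (A : Matrix (Fin n) (Fin n) ℂ) = toComplex n (diagonal d) := by
  obtain ⟨H, rfl, hH⟩ := hA
  obtain ⟨x, hx, hHx⟩ := H.2
  have h1 : ∀ i, ∃ r : ℝ, 0 < r ∧ (x i : ℂ) = r := by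
    intro i
    obtain ⟨r, hr, hr'⟩ := hH (coordChar i) (isAlgebraicCharacter_coordChar i)
    refine ⟨r, hr, ?_⟩
    rw [← hr']
    change _ = ((H : GL (Fin n) ℂ) : Matrix (Fin n) (Fin n) ℂ) i i
    rw [hHx, diagonal_apply_eq]
  choose d hd hxd using h1
  refine ⟨d, hd, fun i => ?_, ?_⟩
  · have := congrArg Units.val (hx i)
    rw [Units.val_mul, hxd, hxd, Units.val_one] at this
    exact_mod_cast this
  · rw [hHx]
    ext a b
    by_cases hab : a = b
    · subst hab
      simp [toComplex_apply, hxd]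
    · simp [toComplex_apply, hab]

theorem isDual_diagonal {n : ℕ} {d : Fin n → ℝ} (hd : ∀ i, d i * d i.rev = 1) :
    IsDual (diagonal d) (diagonal d) := by
  unfold IsDual
  ext a b
  rw [diagonal_transpose, mul_diagonal, diagonal_mul, OmegaReal_apply]
  by_cases h : b = a.rev
  · rw [if_pos h, h, mul_right_comm, hd, one_mul]
  · rw [if_neg h, mul_zero, zero_mul]

theorem GOmegaNonneg_subset {n : ℕ} {A : GL (Fin n) ℂ} (hA : A ∈ GOmegaNonneg n) :
    A ∈ GOmega n ∧ IsTotallyNonneg (A : Matrix (Fin n) (Fin n) ℂ) := by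
  have main : ∃ M : Matrix (Fin n) (Fin n) ℝ, PreservesMinors M ∧ IsDual M M ∧
      (A : Matrix (Fin n) (Fin n) ℂ) = toComplex n M := by
    refine Submonoid.closure_induction (motive := fun (A : GL (Fin n) ℂ) _ =>
      ∃ M : Matrix (Fin n) (Fin n) ℝ, PreservesMinors M ∧ IsDual M M ∧
        (A : Matrix (Fin n) (Fin n) ℂ) = toComplex n M)
      ?_ ?_ ?_ hA
    · rintro A (hA | ⟨i, h1, h2, t, ht, hA⟩)
      · obtain ⟨d, hd, hdr, hA⟩ := exists_diagonal_of_mem_torusPos hA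
        exact ⟨_, preservesMinors_diagonal fun i => (hd i).le, isDual_diagonal hdr, hA⟩
      · obtain ⟨G, hG, hG', hGd, hexp⟩ := exists_exp_chevE h1 h2 ht
        rcases hA with rfl | rfl
        · exact ⟨G, hG, hGd, hexp⟩
        · refine ⟨Gᵀ, hG', hGd.transpose, ?_⟩
          rw [toComplex_transpose, ← hexp, ← exp_transpose, transpose_smul]
          rfl
    · exact ⟨1, PreservesMinors.one, IsDual.one, by simp⟩
    · rintro A B - - ⟨M, hM, hMd, hA⟩ ⟨N, hN, hNd, hB⟩
      exact ⟨M * N, hM.mul hN, hMd.mul hNd, by rw [Units.val_mul, hA, hB, map_mul]⟩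
  obtain ⟨M, hM, hMd, hA⟩ := main
  refine ⟨(mem_GOmega_iff hA).2 hMd, ?_⟩
  rw [hA]
  exact isTotallyNonneg_toComplex.2 hM.realTNN

/-! ### Positive diagonal matrices lie in `T_{>0}` -/

/-- The one-parameter subgroup of the torus with exponents `a`. -/
noncomputable def oneParam {n : ℕ} (a : Fin n → ℝ) (ha : ∀ i, a i + a i.rev = 0) :
    Multiplicative ℝ →* torus n :=
  MonoidHom.mk' (fun s => ⟨⟨diagonal fun i => Complex.exp (s.toAdd * a i),
      diagonal fun i => Complex.exp (-(s.toAdd * a i)), by simp [← Complex.exp_add],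
      by simp [← Complex.exp_add]⟩,
      fun i => Units.mk0 (Complex.exp (s.toAdd * a i)) (Complex.exp_ne_zero _), by
        intro i
        ext
        rw [Units.val_mul, Units.val_mk0, Units.val_mk0, ← Complex.exp_add, ← mul_add,
          ← Complex.ofReal_add, ha]
        simp, rfl⟩) (by
    intro s t
    ext i j
    by_cases hij : i = j
    · subst hij
      simp [← Complex.exp_add, add_mul]
    · simp [hij])

theorem coe_oneParam {n : ℕ} (a : Fin n → ℝ) (ha : ∀ i, a i + a i.rev = 0)
    (s : Multiplicative ℝ) :
    ((oneParam a ha s : GL (Fin n) ℂ) : Matrix (Fin n) (Fin n) ℂ) =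
      diagonal fun i => Complex.exp (s.toAdd * a i) := rfl

/-- The exponential character of the additive group of `ℝ` with real exponent `l`. -/
noncomputable def expChar (l : ℝ) : Multiplicative ℝ →* ℂ where
  toFun s := Complex.exp (s.toAdd * l)
  map_one' := by simp
  map_mul' s t := by simp [← Complex.exp_add, add_mul]

theorem expChar_zero : (expChar 0 : Multiplicative ℝ → ℂ) = 1 := by
  ext s
  simp [expChar]

theorem expChar_add (l m : ℝ) :
    (expChar (l + m) : Multiplicative ℝ → ℂ) = expChar l * expChar m := by
  ext s
  simp [expChar, ← Complex.exp_add, mul_add]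

/-- Real exponentials are closed under products, so their span is an algebra. It contains the matrix
entries and the inverse determinant along the one-parameter subgroup, hence every polynomial in
them. -/
theorem mem_span_expChar {n : ℕ} (a : Fin n → ℝ) (ha : ∀ i, a i + a i.rev = 0)
    (p : MvPolynomial (Option (Fin n × Fin n)) ℂ) :
    (fun s => MvPolynomial.eval (coords (oneParam a ha s : GL (Fin n) ℂ)) p) ∈
      Submodule.span ℂ (Set.image (fun f : Multiplicative ℝ →* ℂ => (f : Multiplicative ℝ → ℂ))
        (Set.range expChar)) := by
  let W : Submonoid (Multiplicative ℝ → ℂ) :=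
    { carrier := Set.image (fun f : Multiplicative ℝ →* ℂ => (f : Multiplicative ℝ → ℂ))
        (Set.range expChar)
      one_mem' := ⟨_, ⟨0, rfl⟩, expChar_zero⟩
      mul_mem' := by
        rintro _ _ ⟨_, ⟨l, rfl⟩, rfl⟩ ⟨_, ⟨m, rfl⟩, rfl⟩
        exact ⟨_, ⟨l + m, rfl⟩, expChar_add l m⟩ }
  have hspan : Subalgebra.toSubmodule (Algebra.adjoin ℂ (W : Set (Multiplicative ℝ → ℂ))) =
      Submodule.span ℂ (W : Set (Multiplicative ℝ → ℂ)) := by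
    rw [Algebra.adjoin_eq_span, Submonoid.closure_eq]
  change _ ∈ Submodule.span ℂ (W : Set (Multiplicative ℝ → ℂ))
  rw [← hspan, Subalgebra.mem_toSubmodule]
  have hexp : ∀ l, (expChar l : Multiplicative ℝ → ℂ) ∈
      Algebra.adjoin ℂ (W : Set (Multiplicative ℝ → ℂ)) := fun l =>
    Algebra.subset_adjoin ⟨_, ⟨l, rfl⟩, rfl⟩
  induction p using MvPolynomial.induction_on with
  | C z =>
    simp only [MvPolynomial.eval_C]
    exact Subalgebra.algebraMap_mem _ z
  | add p q hp hq =>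
    simp only [map_add]
    exact Subalgebra.add_mem _ hp hq
  | mul_X p k hp =>
    simp only [map_mul, MvPolynomial.eval_X]
    refine Subalgebra.mul_mem _ hp ?_
    rcases k with _ | ⟨i, j⟩
    · convert hexp (-∑ i, a i) using 1
      ext s
      rw [coords, coe_oneParam, det_diagonal, ← Complex.exp_sum, ← Complex.exp_neg,
        ← Finset.mul_sum]
      simp [expChar]
    · by_cases hij : i = j
      · subst hij
        convert hexp (a i) using 1
        ext s
        simp only [coords, coe_oneParam, diagonal_apply_eq]
        rfl
      · convert Subalgebra.zero_mem (Algebra.adjoin ℂ (W : Set (Multiplicative ℝ → ℂ))) using 1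
        ext s
        simp [coords, coe_oneParam, hij]

/-- The restricted character is a homomorphism lying in the span of the `expChar l`. By Dedekind's
independence of characters it equals one of them, and the exponent `l` is real. -/
theorem IsAlgebraicCharacter.pos_oneParam {n : ℕ} {χ : torus n →* ℂˣ}
    (hχ : IsAlgebraicCharacter χ) (a : Fin n → ℝ) (ha : ∀ i, a i + a i.rev = 0)
    (s : Multiplicative ℝ) : ∃ x : ℝ, 0 < x ∧ (χ (oneParam a ha s) : ℂ) = x := by
  obtain ⟨p, hp⟩ := hχ
  let F : Multiplicative ℝ →* ℂ := (Units.coeHom ℂ).comp (χ.comp (oneParam a ha))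
  have hF : F ∈ Set.range expChar := by
    by_contra hF
    refine (linearIndependent_monoidHom (Multiplicative ℝ) ℂ).notMem_span_image hF ?_
    convert mem_span_expChar a ha p using 1
    ext s
    exact hp _
  obtain ⟨l, hl⟩ := hF
  refine ⟨Real.exp (s.toAdd * l), Real.exp_pos _, ?_⟩
  change F s = _
  rw [← hl]
  simp [expChar]

theorem exists_mem_torusPos {n : ℕ} {d : Fin n → ℝ} (hd : ∀ i, 0 < d i)
    (hdr : ∀ i, d i * d i.rev = 1) :
    ∃ g ∈ torusPos n, (g : Matrix (Fin n) (Fin n) ℂ) = toComplex n (diagonal d) := by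
  have ha : ∀ i, Real.log (d i) + Real.log (d i.rev) = 0 := by
    intro i
    rw [← Real.log_mul (hd _).ne' (hd _).ne', hdr, Real.log_one]
  refine ⟨_, ⟨oneParam (fun i => Real.log (d i)) ha (Multiplicative.ofAdd 1), rfl,
    fun χ hχ => hχ.pos_oneParam _ _ _⟩, ?_⟩
  rw [coe_oneParam]
  ext i j
  by_cases hij : i = j
  · subst hij
    rw [diagonal_apply_eq, toComplex_apply, diagonal_apply_eq, toAdd_ofAdd, Complex.ofReal_one,
      one_mul, ← Complex.ofReal_exp, Real.exp_log (hd i)]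
  · rw [diagonal_apply_ne _ hij, toComplex_apply, diagonal_apply_ne _ hij, Complex.ofReal_zero]

/-! ### Assembly of the factors -/

/-- The real matrix `M` is an element of `G_{≥0}(Ω_n)`. -/
def IsRealPoint {n : ℕ} (M : Matrix (Fin n) (Fin n) ℝ) : Prop :=
  ∃ g ∈ GOmegaNonneg n, (g : Matrix (Fin n) (Fin n) ℂ) = toComplex n M

theorem IsRealPoint.one {n : ℕ} : IsRealPoint (1 : Matrix (Fin n) (Fin n) ℝ) :=
  ⟨1, one_mem _, by simp⟩

theorem IsRealPoint.mul {n : ℕ} {M N : Matrix (Fin n) (Fin n) ℝ} (hM : IsRealPoint M)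
    (hN : IsRealPoint N) : IsRealPoint (M * N) := by
  obtain ⟨g, hg, hgM⟩ := hM
  obtain ⟨h, hh, hhN⟩ := hN
  exact ⟨g * h, mul_mem hg hh, by rw [Units.val_mul, hgM, hhN, map_mul]⟩

theorem isRealPoint_exp {n i : ℕ} (h1 : 1 ≤ i) (h2 : i ≤ n / 2) {t : ℝ} (ht : 0 < t)
    {G : Matrix (Fin n) (Fin n) ℝ}
    (hG : NormedSpace.exp ((t : ℂ) • chevE n i) = toComplex n G) :
    IsRealPoint G ∧ IsRealPoint Gᵀ := by
  refine ⟨⟨expGL ((t : ℂ) • chevE n i), Submonoid.subset_closure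
    (Or.inr ⟨i, h1, h2, t, ht, Or.inl rfl⟩), hG⟩, ⟨expGL ((t : ℂ) • chevF n i),
    Submonoid.subset_closure (Or.inr ⟨i, h1, h2, t, ht, Or.inr rfl⟩), ?_⟩⟩
  rw [toComplex_transpose, ← hG, ← exp_transpose, transpose_smul]
  rfl

/-- Both `U` and `Uᵀ` are carried through the induction, since transposition exchanges the
generators from `E_i` and `F_i`; the second half serves the lower factor `L`. -/
theorem isRealPoint_of_unipotent {n : ℕ} {U : Matrix (Fin n) (Fin n) ℝ}
    (hU : IsUpperUnipotent U) (hQ : InitNonneg U) (hD : IsDual U U) :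
    IsRealPoint U ∧ IsRealPoint Uᵀ := by
  have mul : ∀ {G V : Matrix (Fin n) (Fin n) ℝ}, IsRealPoint G ∧ IsRealPoint Gᵀ →
      IsRealPoint V ∧ IsRealPoint Vᵀ → IsRealPoint (G * V) ∧ IsRealPoint (G * V)ᵀ := by
    intro G V hG hV
    rw [transpose_mul]
    exact ⟨hG.1.mul hV.1, hV.2.mul hG.2⟩
  refine selfDual_induction (C := fun U => IsRealPoint U ∧ IsRealPoint Uᵀ) ?_ ?_ ?_ ?_ U hU hQ hD
  · rw [transpose_one]
    exact ⟨IsRealPoint.one, IsRealPoint.one⟩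
  · intro i j t V hn hij ht hV
    exact mul (isRealPoint_exp (by omega) (by omega) ht (exp_chevE_of_lt hn hij t)) hV
  · intro i t V hn ht hV
    exact mul (isRealPoint_exp (by omega) (by omega) ht (exp_chevE_even hn t)) hV
  · intro i t V hn ht hV
    -- Dividing by `√2` compensates the normalization of `E_k` for odd `n`.
    have h := exp_chevE_odd hn (t / √2)
    rw [div_mul_cancel₀ _ (by positivity)] at h
    exact mul (isRealPoint_exp (by omega) (by omega) (by positivity) h) hV

theorem mem_GOmegaNonneg {n : ℕ} {A : GL (Fin n) ℂ} (hA : A ∈ GOmega n)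
    (hT : IsTotallyNonneg (A : Matrix (Fin n) (Fin n) ℂ)) : A ∈ GOmegaNonneg n := by
  obtain ⟨M, hM⟩ := hT.exists_real
  have hD : IsDual M M := (mem_GOmega_iff hM).1 hA
  rw [hM, isTotallyNonneg_toComplex] at hT
  have hdet : M.det ≠ 0 := by
    intro h0
    have h1 : (A : Matrix (Fin n) (Fin n) ℂ).det ≠ 0 :=
      ((isUnit_iff_isUnit_det _).1 A.isUnit).ne_zero
    rw [hM, ← RingHom.map_det, h0, map_zero] at h1
    exact h1 rfl
  obtain ⟨L, U, d, hL, hU, hd, rfl⟩ := hT.exists_ldu hdet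
  obtain ⟨hLd, hUd, hdd⟩ := IsDual.ldu hL hU hd hD
  have hQU : InitNonneg U := InitNonneg.of_ldu hL hd hT
  -- Transposing the Gauss decomposition makes `Lᵀ` its upper factor.
  have hQL : InitNonneg Lᵀ := by
    have hT' := hT.transpose
    rw [transpose_mul, transpose_mul, diagonal_transpose, ← Matrix.mul_assoc] at hT'
    exact InitNonneg.of_ldu (L := Uᵀ) (by rwa [transpose_transpose]) hd hT'
  have hRL : IsRealPoint L := by
    have := (isRealPoint_of_unipotent hL hQL hLd).2
    rwa [transpose_transpose] at this
  have hRD : IsRealPoint (diagonal d) := by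
    obtain ⟨g, hg, hgd⟩ := exists_mem_torusPos hd hdd
    exact ⟨g, Submonoid.subset_closure (Or.inl hg), hgd⟩
  obtain ⟨g, hg, hgA⟩ := (hRL.mul hRD).mul (isRealPoint_of_unipotent hU hQU hUd).1
  have : A = g := Units.ext (hM.trans hgA.symm)
  rwa [this]

end TotalPos

theorem mainTheorem2 (n : ℕ) :
    (∀ A ∈ TotalPos.GOmega n, TotalPos.IsTotallyNonneg (A : Matrix (Fin n) (Fin n) ℂ) →
      A ∈ TotalPos.GOmegaNonneg n) ∧
    (TotalPos.GOmegaNonneg n : Set (GL (Fin n) ℂ)) =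
      {A | A ∈ TotalPos.GOmega n ∧
        TotalPos.IsTotallyNonneg (A : Matrix (Fin n) (Fin n) ℂ)} := by
  refine ⟨fun A hA hT => TotalPos.mem_GOmegaNonneg hA hT, Set.Subset.antisymm ?_ ?_⟩
  · intro A hA
    exact TotalPos.GOmegaNonneg_subset hA
  · rintro A ⟨hA, hT⟩
    exact TotalPos.mem_GOmegaNonneg hA hT
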